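/- Let $\zeta$ be the Riemann zeta function and let $\Xi(s)=\pi^{-s/2}\,s(s-1)\,\Gamma(s/2)\,\zeta(s)$, an entire function with $\Xi(s)=\Xi(1-s)$. List the nontrivial zeros of $\zeta$, repeated by multiplicity, in pairs $\rho=\tfrac12\pm i\tau_k$ $(k=1,2,\dots)$ with $\operatorname{Re}\tau_k>0$ non-decreasing (the Riemann Hypothesis is not assumed), and put $$\mathcal Z(\sigma,v)=\sum_{k\ge1}(\tau_k^2+v)^{-\sigma}\quad(\operatorname{Re}\sigma>\tfrac12),\qquad \mathcal Z(\sigma)=\mathcal Z(\sigma,0),$$ where $v$ is real with $v>-(\operatorname{Re}\tau_k)^2$ for all $k$ (that is, $v>-\tau_1^2$, since $\tau_1$ is real). Let also $$\mathbf Z(s)=\sum_{k\ge1}\bigl(\tfrac12+2k\bigr)^{-s}\quad(\operatorname{Re}s>1),\qquad \beta(s)=L(\chi_4,s)=\sum_{k\ge1}(-1)^{k+1}(2k-1)^{-s}.$$ (i) For every such $v$, every integer $n\ge1$ and either choice of the sign, the series $\mathcal Z(n,v)$ converges absolutely, $\Xi(\tfrac12\pm\sqrt v)\neq0$, the function $v\mapsto\log\Xi(\tfrac12\pm\sqrt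 v)$ is $n$ times continuously differentiable near $v$, and $$\mathcal Z(n,v)=\frac{(-1)^{n-1}}{(n-1)!}\,\frac{d^n}{dv^n}\log\Xi\bigl(\tfrac12\pm\sqrt v\bigr).$$ (ii) For every integer $m\ge1$, the series $\mathcal Z(m)$ and $\mathbf Z(2m)$ converge absolutely, $\zeta(\tfrac12)\ne0$, the function $\log|\zeta|$ on the real axis is $2m$ times continuously differentiable near $\tfrac12$, and $$2(-1)^{m+1}\mathcal Z(m)-\frac{(\log|\zeta|)^{(2m)}(\frac12)}{(2m-1)!}=\mathbf Z(2m)-2^{2m},$$ where $$\mathbf Z(2m)=\tfrac12\bigl[(2^{2m}-1)\zeta(2m)+2^{2m}\beta(2m)\bigr]-2^{2m};$$ consequently $$\mathcal Z(m)=(-1)^m\Bigl\{-\frac{(\log|\zeta|)^{(2m)}(\frac12)}{2\,(2m-1)!}-\tfrac14\bigl[(2^{2m}-1)\zeta(2m)+2^{2m}\beta(2m)\bigr]+2^{2m}\Bigr\}.$$ -/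

import Mathlib

/-- The entire function `Ξ(s) = s (s - 1) π^(-s/2) Γ(s/2) ζ(s)`, written through Mathlib's entire
function `Λ₀(s) = π^(-s/2) Γ(s/2) ζ(s) + 1/s + 1/(1-s)`, so that the removable singularities of
`ζ(s) / F(s)` (at `0`, `1` and the trivial zeros) carry the right values;
see `riemannXiEntire_eq_div`. -/
noncomputable def riemannXiEntire (s : ℂ) : ℂ :=
  s * (s - 1) * completedRiemannZeta₀ s + 1

/-- The factor `F(s) = π^(s/2) / (s (s - 1) Γ(s/2))`. -/
noncomputable def riemannXiFactor (s : ℂ) : ℂ :=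
  (Real.pi : ℂ) ^ (s / 2) / (s * (s - 1) * Complex.Gamma (s / 2))

/-- `Ξ(s) = ζ(s) / F(s)` wherever the right-hand side is literally defined. -/
theorem riemannXiEntire_eq_div {s : ℂ} (h1 : s ≠ 1) (hs : ∀ n : ℕ, s ≠ -(2 * n)) :
    riemannXiEntire s = riemannZeta s / riemannXiFactor s := by
  have h0 : s ≠ 0 := by simpa using hs 0
  have hG : Complex.Gamma (s / 2) ≠ 0 := by
    refine Complex.Gamma_ne_zero fun n hn => hs n ?_
    linear_combination 2 * hn
  have hpi : (Real.pi : ℂ) ≠ 0 := by exact_mod_cast Real.pi_ne_zero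
  have hpp : (Real.pi : ℂ) ^ (s / 2) ≠ 0 := by simp [Complex.cpow_eq_zero_iff, hpi]
  have h1' : s - 1 ≠ 0 := sub_ne_zero.mpr h1
  have h1'' : (1 : ℂ) - s ≠ 0 := sub_ne_zero.mpr (Ne.symm h1)
  rw [riemannZeta_def_of_ne_zero h0, completedRiemannZeta_eq, Complex.Gammaℝ_def, neg_div,
    Complex.cpow_neg]
  unfold riemannXiEntire riemannXiFactor
  field_simp
  ring

theorem differentiable_riemannXiEntire : Differentiable ℂ riemannXiEntire := by
  unfold riemannXiEntire
  exact ((differentiable_id.mul (differentiable_id.sub_const 1)).mul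
    differentiable_completedZeta₀).add_const 1

/-- The nontrivial zeros of `ζ` in the upper half plane: one zero `ρ = 1/2 + i τ`, `Re τ > 0`, of
each pair `{ρ, 1 - ρ} = {1/2 + i τ, 1/2 - i τ}`. -/
def upperNontrivialZeros : Set ℂ :=
  {ρ | riemannZeta ρ = 0 ∧ 0 < ρ.re ∧ ρ.re < 1 ∧ 0 < ρ.im}

/-- The parameter `τ` of a zero `ρ = 1/2 + i τ`. -/
noncomputable def zeroTau (ρ : ℂ) : ℂ := (ρ - 1 / 2) / Complex.I

/-- The contribution `(τ² + v)^(-σ)` of the zero `ρ = 1/2 + i τ`, times the multiplicity of `ρ`. -/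
noncomputable def zerosZetaTerm (σ : ℂ) (v : ℝ) (ρ : upperNontrivialZeros) : ℂ :=
  (analyticOrderNatAt riemannZeta (ρ : ℂ) : ℂ) * (zeroTau ρ ^ 2 + (v : ℂ)) ^ (-σ)

/-- `𝒵(σ, v) = ∑ₖ (τₖ² + v)^(-σ)` (for `Re σ > 1/2`), the `τₖ` repeated by multiplicity. -/
noncomputable def zerosZeta (σ : ℂ) (v : ℝ) : ℂ :=
  ∑' ρ : upperNontrivialZeros, zerosZetaTerm σ v ρ

/-- `β(s) = L(χ₄, s)`, the entire continuation of `∑ (-1)^(k+1) (2k-1)^(-s)`. -/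
noncomputable def betaL (s : ℂ) : ℂ :=
  DirichletCharacter.LFunction (ZMod.χ₄.ringHomComp (Int.castRingHom ℂ)) s

/-- The term of index `k + 1` of `𝐙(s) = ∑_{k ≥ 1} (1/2 + 2k)^(-s)`. -/
noncomputable def shadowZetaTerm (s : ℂ) (k : ℕ) : ℂ :=
  (1 / 2 + 2 * ((k : ℂ) + 1)) ^ (-s)

/-- The zeta function `𝐙(s) = ∑_{k ≥ 1} (1/2 + 2k)^(-s)` (for `Re s > 1`) of the trivial zeros. -/
noncomputable def shadowZeta (s : ℂ) : ℂ := ∑' k : ℕ, shadowZetaTerm s k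

/-- `log |ζ|` on the real axis. -/
noncomputable def logAbsZeta (x : ℝ) : ℝ := Real.log ‖riemannZeta (x : ℂ)‖

/-- `v ↦ log Ξ(1/2 + ε √v)` for real `v`, where `ε = ±1` is the sign. -/
noncomputable def logXiShift (ε : ℂ) (v : ℝ) : ℂ :=
  Complex.log (riemannXiEntire (1 / 2 + ε * (v : ℂ) ^ (1 / 2 : ℂ)))

/-! Put w = (s - 1/2)². The functional equation makes Ξ(1/2 + t) even in t, so Ξ(1/2 + √w) is an
entire function `xiSq` of w, and its zeros are the numbers -τₖ² with the multiplicities of the zeros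
of ζ. Everything follows from the partial fraction expansion (log `xiSq`)'(w) = ∑ₖ 1 / (w + τₖ²),
whose derivatives at w = v give the series 𝒵(n, v).

The expansion comes from growth. `completedRiemannZeta₀` is the Mellin transform of a nonnegative
kernel, so |Λ₀(s)| ≤ Λ₀(Re s), and comparison with an even integer 2n gives log |`xiSq` w| = O(√|w|
log |w|), which is o(|w|). For any entire f with f(0) ≠ 0 and log |f(z)| ≤ o(|z|), removing the
zeros of modulus at most R and applying Borel–Carathéodory and Cauchy to the logarithm of the
quotient shows that f'/f minus the sum over these zeros tends to 0 (`norm_logDeriv_sub_sum_le`). No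
zero counting is needed for absolute convergence: nontrivial zeros lie in the critical strip, so the
large zeros of `xiSq` lie in a sector around the negative axis, where 1/|w| is controlled by
Re(-1/w), and the sums of the latter already converge (`summable_zeros_and_logDeriv_eq`).

The same positivity shows Ξ > 0 on [0, 1]. Hence ζ(1/2) ≠ 0 and no zero is real, so the upper half
plane contains exactly one zero of each pair {ρ, 1 - ρ}. On the real line `xiSq` is real, and it is
positive to the right of its real zeros, so the principal logarithm is analytic there.

For (ii), on 0 < x < 1, log |ζ(x)| = log `xiSq`((x - 1/2)²) - log x - log(1 - x) + (x/2) log π - log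
Γ(x/2). At x = 1/2 the derivative of order 2m of the first term is 2 (2m-1)! (-1)^(m-1) 𝒵(m), the
two elementary logarithms produce powers of 2, and the polygamma series at 1/4 is 𝐙(2m) up to
scaling and its initial term. Splitting the odd integers modulo 4 expresses this series through
ζ(2m) and β(2m). -/

section

/-! ### Positivity of the theta kernel and bounds for Λ₀. -/

open Complex MeasureTheory Set Filter Topology HurwitzZeta

/-- The nonnegative real kernel whose Mellin transform is `s ↦ 2 Λ₀(2 s)`. -/
noncomputable def zetaKernel (x : ℝ) : ℝ :=
  if 1 < x then evenKernel 0 x - 1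
  else if x < 1 then evenKernel 0 x - x ^ (-(1 / 2) : ℝ) else 0

theorem one_le_evenKernel_zero {x : ℝ} (hx : 0 < x) : 1 ≤ evenKernel 0 x := by
  have h := hasSum_int_evenKernel₀ 0 hx
  simp only [QuotientAddGroup.mk_zero, if_true] at h
  have := h.nonneg fun n => by split_ifs <;> positivity
  linarith

/-- For x < 1 the functional equation θ(x) = x^(-1/2) θ(1/x) reduces the claim to θ(1/x) ≥ 1. -/
theorem zetaKernel_nonneg {x : ℝ} (hx : 0 < x) : 0 ≤ zetaKernel x := by
  unfold zetaKernel
  split_ifs with h1 h2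
  · linarith [one_le_evenKernel_zero hx]
  · rw [evenKernel_functional_equation, ← evenKernel_eq_cosKernel_of_zero, Real.rpow_neg hx.le,
      ← one_div]
    have h3 : 0 < 1 / x ^ (1 / 2 : ℝ) := by positivity
    have := one_le_evenKernel_zero (one_div_pos.mpr hx)
    nlinarith
  · exact le_rfl

theorem f_modif_eq_zetaKernel {x : ℝ} (hx : 0 < x) :
    (hurwitzEvenFEPair 0).f_modif x = (zetaKernel x : ℂ) := by
  unfold WeakFEPair.f_modif zetaKernel
  rcases lt_trichotomy 1 x with h | h | h
  · simp [h, h.not_gt, hurwitzEvenFEPair]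
  · simp [← h]
  · simp [h, h.not_gt, hx, hurwitzEvenFEPair]

theorem mellinConvergent_f_modif (s : ℂ) :
    MellinConvergent (hurwitzEvenFEPair 0).f_modif s := by
  have hP := (hurwitzEvenFEPair 0).isStrongFEPair_toStrongFEPair
  obtain ⟨_, ht⟩ := exists_gt s.re
  obtain ⟨_, hu⟩ := exists_lt s.re
  exact mellinConvergent_of_isBigO_rpow (hurwitzEvenFEPair 0).hf_modif_int (hP.hf_top _) ht
    (hP.hf_zero _) hu

theorem integrableOn_rpow_mul_zetaKernel (σ : ℝ) :
    IntegrableOn (fun x : ℝ => x ^ (σ / 2 - 1) * zetaKernel x) (Ioi 0) := by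
  have h := (mellinConvergent_f_modif ((σ / 2 : ℝ) : ℂ)).norm
  refine IntegrableOn.congr_fun h (fun x hx => ?_) measurableSet_Ioi
  simp only [smul_eq_mul, norm_mul]
  rw [norm_cpow_eq_rpow_re_of_pos hx, f_modif_eq_zetaKernel hx, norm_real, Real.norm_eq_abs,
    abs_of_nonneg (zetaKernel_nonneg hx)]
  simp

/-- The value of `Λ₀` at the real point `σ`. -/
noncomputable def realLambda (σ : ℝ) : ℝ :=
  (∫ x in Ioi (0 : ℝ), x ^ (σ / 2 - 1) * zetaKernel x) / 2

theorem completedRiemannZeta₀_eq_integral (s : ℂ) :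
    completedRiemannZeta₀ s = (∫ x in Ioi (0 : ℝ), (x : ℂ) ^ (s / 2 - 1) * zetaKernel x) / 2 := by
  change mellin (hurwitzEvenFEPair 0).f_modif (s / 2) / 2 = _
  rw [mellin]
  congr 1
  refine setIntegral_congr_fun measurableSet_Ioi fun x hx => ?_
  simp only [smul_eq_mul, f_modif_eq_zetaKernel hx]

theorem completedRiemannZeta₀_ofReal (σ : ℝ) :
    completedRiemannZeta₀ σ = (realLambda σ : ℂ) := by
  rw [completedRiemannZeta₀_eq_integral, realLambda]
  push_cast
  rw [← integral_complex_ofReal]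
  congr 1
  refine setIntegral_congr_fun measurableSet_Ioi fun x hx => ?_
  change _ = ((x ^ (σ / 2 - 1) * zetaKernel x : ℝ) : ℂ)
  rw [ofReal_mul, ofReal_cpow (le_of_lt hx)]
  push_cast
  rfl

theorem norm_completedRiemannZeta₀_le (s : ℂ) :
    ‖completedRiemannZeta₀ s‖ ≤ realLambda s.re := by
  rw [completedRiemannZeta₀_eq_integral, realLambda, norm_div, norm_ofNat]
  gcongr
  refine (norm_integral_le_integral_norm _).trans_eq ?_
  refine setIntegral_congr_fun measurableSet_Ioi fun x hx => ?_
  simp only [norm_mul]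
  rw [norm_cpow_eq_rpow_re_of_pos hx, norm_real, Real.norm_eq_abs,
    abs_of_nonneg (zetaKernel_nonneg hx)]
  simp

/-- Since the kernel is nonnegative, it suffices to bound the power of x by its value at exponent b
for x ≥ 1 and at exponent a for x ≤ 1. This crude form of convexity replaces any finer estimate of
Λ₀. -/
theorem realLambda_le_add {a b σ : ℝ} (ha : a ≤ σ) (hb : σ ≤ b) :
    realLambda σ ≤ realLambda a + realLambda b := by
  unfold realLambda
  rw [← add_div, ← integral_add (integrableOn_rpow_mul_zetaKernel a)
    (integrableOn_rpow_mul_zetaKernel b)]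
  gcongr ?_ / 2
  refine setIntegral_mono_on (integrableOn_rpow_mul_zetaKernel σ)
    ((integrableOn_rpow_mul_zetaKernel a).add (integrableOn_rpow_mul_zetaKernel b))
    measurableSet_Ioi fun x hx => ?_
  have hx' : 0 < x := hx
  rw [← add_mul]
  refine mul_le_mul_of_nonneg_right ?_ (zetaKernel_nonneg hx)
  have h1 : 0 ≤ x ^ (a / 2 - 1) := by positivity
  have h2 : 0 ≤ x ^ (b / 2 - 1) := by positivity
  rcases le_total 1 x with h | h
  · have := Real.rpow_le_rpow_of_exponent_le h (show σ / 2 - 1 ≤ b / 2 - 1 by linarith)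
    linarith
  · have := Real.rpow_le_rpow_of_exponent_ge hx' h (show a / 2 - 1 ≤ σ / 2 - 1 by linarith)
    linarith

theorem completedRiemannZeta₀_conj (s : ℂ) :
    completedRiemannZeta₀ (starRingEnd ℂ s) = starRingEnd ℂ (completedRiemannZeta₀ s) := by
  rw [completedRiemannZeta₀_eq_integral, completedRiemannZeta₀_eq_integral, map_div₀,
    ← integral_conj]
  simp only [map_ofNat]
  congr 1
  refine setIntegral_congr_fun measurableSet_Ioi fun x hx => ?_
  simp only [map_mul, conj_ofReal]
  congr 1
  have h := cpow_conj (x : ℂ) (s / 2 - 1)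
    (by rw [arg_ofReal_of_nonneg (le_of_lt hx)]; exact Real.pi_pos.ne)
  rwa [map_sub, map_div₀, map_ofNat, map_one, conj_ofReal] at h

theorem riemannXiEntire_conj (s : ℂ) :
    riemannXiEntire (starRingEnd ℂ s) = starRingEnd ℂ (riemannXiEntire s) := by
  simp [riemannXiEntire, completedRiemannZeta₀_conj]

theorem riemannXiEntire_one_sub (s : ℂ) : riemannXiEntire (1 - s) = riemannXiEntire s := by
  simp only [riemannXiEntire, completedRiemannZeta₀_one_sub]
  ring

theorem riemannXiEntire_one : riemannXiEntire 1 = 1 := by simp [riemannXiEntire]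

theorem realLambda_one_lt : realLambda 1 < 3 / 2 := by
  have h := completedRiemannZeta₀_ofReal 1
  rw [ofReal_one, completedRiemannZeta₀_one] at h
  have h2 : realLambda 1 = (Real.eulerMascheroniConstant - Real.log (4 * Real.pi)) / 2 + 1 := by
    rw [← ofReal_inj, ← h]
    push_cast [ofReal_log (show (0:ℝ) ≤ 4 * Real.pi by positivity)]
    rfl
  have h3 : 0 < Real.log (4 * Real.pi) := Real.log_pos (by linarith [Real.pi_gt_three])
  linarith [Real.eulerMascheroniConstant_lt_two_thirds]

theorem realLambda_one_sub (σ : ℝ) : realLambda (1 - σ) = realLambda σ := by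
  rw [← ofReal_inj, ← completedRiemannZeta₀_ofReal, ← completedRiemannZeta₀_ofReal, ofReal_sub,
    ofReal_one, completedRiemannZeta₀_one_sub]

/-- Here Ξ(σ) = 1 - σ(1 - σ) Λ₀(σ), with σ(1 - σ) ≤ 1/4 and Λ₀(σ) ≤ Λ₀(0) + Λ₀(1) = 2 Λ₀(1) < 3, so
Ξ(σ) > 1/4. -/
theorem riemannXiEntire_ne_zero_of_mem_Icc {σ : ℝ} (h : σ ∈ Icc (0 : ℝ) 1) :
    riemannXiEntire σ ≠ 0 := by
  have h1 : realLambda σ < 3 := by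
    have := realLambda_le_add h.1 h.2
    have h2 := realLambda_one_sub 1
    rw [sub_self] at h2
    linarith [realLambda_one_lt]
  have h3 : riemannXiEntire σ = ((σ * (σ - 1) * realLambda σ + 1 : ℝ) : ℂ) := by
    rw [riemannXiEntire, completedRiemannZeta₀_ofReal]
    push_cast
    ring
  rw [h3, Ne, ofReal_eq_zero]
  have h4 : 0 ≤ σ * (1 - σ) := mul_nonneg h.1 (by linarith [h.2])
  have h5 : σ * (1 - σ) ≤ 1 / 4 := by nlinarith [sq_nonneg (σ - 1 / 2)]
  nlinarith

end

/-! ### The entire function Ξ(1/2 + √w) and its growth. -/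

section

open Complex Set Filter Topology Asymptotics

/-- The entire function `w ↦ Ξ(1/2 + √w)`. -/
noncomputable def xiSq (w : ℂ) : ℂ := riemannXiEntire (1 / 2 + w ^ (1 / 2 : ℂ))

theorem cpow_half_sq (w : ℂ) : (w ^ (1 / 2 : ℂ)) ^ 2 = w := by
  rw [← cpow_nat_mul]
  simp

/-- The principal root of t² is t or -t, and Ξ(1/2 + t) is even in t; the choice of branch is
therefore immaterial. -/
theorem xiSq_sq (t : ℂ) : xiSq (t ^ 2) = riemannXiEntire (1 / 2 + t) := by
  rw [xiSq]
  rcases sq_eq_sq_iff_eq_or_eq_neg.mp (cpow_half_sq (t ^ 2)) with h | h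
  · rw [h]
  · rw [h, ← riemannXiEntire_one_sub]
    congr 1
    ring

theorem differentiable_xiSq : Differentiable ℂ xiSq := by
  have hΞ := differentiable_riemannXiEntire
  have hne : ∀ w : ℂ, w ≠ 0 → DifferentiableAt ℂ xiSq w := fun w hw => by
    by_cases h : w ∈ slitPlane
    · exact (hΞ _).comp w ((differentiableAt_id.cpow_const h).const_add _)
    -- On the branch cut the other description √w = ± i √(-w) is holomorphic; the sign does not
    -- matter by evenness.
    · have h' : -w ∈ slitPlane := by
        rw [mem_slitPlane_iff] at h ⊢
        push Not at h
        rcases h.1.lt_or_eq with h1 | h1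
        · left
          simpa using h1
        · exact absurd (Complex.ext h1 h.2) hw
      have h2 : xiSq = fun u => riemannXiEntire (1 / 2 + I * (-u) ^ (1 / 2 : ℂ)) := funext fun u => by
        rw [← xiSq_sq, mul_pow, cpow_half_sq, I_sq]
        simp
      rw [h2]
      exact (hΞ _).comp w (((differentiableAt_id.neg.cpow_const h').const_mul I).const_add _)
  have h0 : ContinuousAt xiSq 0 := by
    have h1 : ContinuousAt (fun w : ℂ => 1 / 2 + w ^ (1 / 2 : ℂ)) 0 :=
      continuousAt_const.add (continuousAt_cpow_const_of_re_pos (by simp) (by norm_num))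
    exact ContinuousAt.comp (f := fun w : ℂ => 1 / 2 + w ^ (1 / 2 : ℂ))
      hΞ.continuous.continuousAt h1
  -- At 0 continuity makes the singularity removable.
  have h2 := (differentiableOn_compl_singleton_and_continuousAt_iff (E := ℂ) (f := xiSq)
    (c := 0) (s := univ) univ_mem).mp ⟨fun w hw => (hne w hw.2).differentiableWithinAt, h0⟩
  exact differentiableOn_univ.mp h2

theorem norm_riemannZeta_two_mul_le {n : ℕ} (hn : 1 ≤ n) :
    ‖riemannZeta (2 * n : ℂ)‖ ≤ ∑' k : ℕ, 1 / (k : ℝ) ^ 2 := by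
  have h := zeta_nat_eq_tsum_of_gt_one (show 1 < 2 * n by omega)
  push_cast at h
  rw [h]
  refine tsum_of_norm_bounded (Real.summable_one_div_nat_pow.mpr one_lt_two).hasSum fun k => ?_
  rw [norm_div, norm_one, norm_pow, norm_natCast]
  rcases Nat.eq_zero_or_pos k with rfl | hk
  · simp [show 2 * n ≠ 0 by omega]
  · have : (1 : ℝ) ≤ k := by exact_mod_cast hk
    gcongr
    omega

theorem realLambda_two_mul_le {n : ℕ} (hn : 1 ≤ n) :
    realLambda (2 * n) ≤ (∑' k : ℕ, 1 / (k : ℝ) ^ 2 + 1) * (n : ℝ) ^ n := by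
  set Z := ∑' k : ℕ, 1 / (k : ℝ) ^ 2
  have hn' : (1 : ℝ) ≤ n := by exact_mod_cast hn
  have hne : (2 * n : ℂ) ≠ 0 := by
    have : (n : ℂ) ≠ 0 := by exact_mod_cast (by omega : n ≠ 0)
    simpa using this
  have hcomp : ‖completedRiemannZeta (2 * n)‖ ≤ Z * (n : ℝ) ^ n := by
    have hG : Gammaℝ (2 * n : ℂ) ≠ 0 := Gammaℝ_ne_zero_of_re_pos (by simp; omega)
    have h1 : completedRiemannZeta (2 * n) = Gammaℝ (2 * n) * riemannZeta (2 * n) := by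
      rw [riemannZeta_def_of_ne_zero hne]
      field_simp
    rw [h1, norm_mul, mul_comm]
    refine mul_le_mul (norm_riemannZeta_two_mul_le hn) ?_ (norm_nonneg _)
      (tsum_nonneg fun _ => by positivity)
    rw [Gammaℝ_def, norm_mul, norm_cpow_eq_rpow_re_of_pos Real.pi_pos,
      show (2 * n : ℂ) / 2 = ((n - 1 : ℕ) : ℂ) + 1 by push_cast [Nat.cast_sub hn]; ring,
      Gamma_nat_eq_factorial, norm_natCast]
    have h2 : Real.pi ^ ((-(2 * n : ℂ) / 2).re) ≤ 1 :=
      Real.rpow_le_one_of_one_le_of_nonpos (by linarith [Real.pi_gt_three])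
      (by simp; linarith)
    have h3 : ((n - 1).factorial : ℝ) ≤ (n : ℝ) ^ n := by
      exact_mod_cast (Nat.factorial_le (Nat.sub_le n 1)).trans (Nat.factorial_le_pow n)
    calc _ ≤ 1 * (n : ℝ) ^ n := by gcongr
      _ = _ := one_mul _
  have h4 : completedRiemannZeta₀ (2 * n) = completedRiemannZeta (2 * n) +
      ((1 / (2 * n) + 1 / (1 - 2 * n) : ℝ) : ℂ) := by
    rw [completedRiemannZeta_eq]
    push_cast
    ring
  have h5 : realLambda (2 * n) ≤ ‖completedRiemannZeta₀ (2 * n)‖ := by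
    have := completedRiemannZeta₀_ofReal (2 * n)
    push_cast at this
    rw [this, norm_real]
    exact Real.le_norm_self _
  have h6 : ‖((1 / (2 * n) + 1 / (1 - 2 * n) : ℝ) : ℂ)‖ ≤ 1 := by
    rw [norm_real, Real.norm_eq_abs, abs_le]
    have h7 : 0 ≤ 1 / (2 * (n : ℝ)) := by positivity
    have h8 : 1 / (2 * (n : ℝ)) ≤ 1 := by
      rw [div_le_one (by positivity)]; linarith
    have h9 : 1 / (1 - 2 * (n : ℝ)) ≤ 0 := one_div_nonpos.mpr (by linarith)
    have h10 : -1 ≤ 1 / (1 - 2 * (n : ℝ)) := by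
      rw [le_div_iff_of_neg (by linarith)]; linarith
    constructor <;> linarith
  have h11 : 1 ≤ (n : ℝ) ^ n := one_le_pow₀ hn'
  calc _ ≤ _ := h5
    _ ≤ ‖completedRiemannZeta (2 * n)‖ + ‖((1 / (2 * n) + 1 / (1 - 2 * n) : ℝ) : ℂ)‖ := by
        rw [h4]
        exact norm_add_le _ _
    _ ≤ Z * (n : ℝ) ^ n + (n : ℝ) ^ n := by linarith
    _ = _ := by ring

theorem realLambda_nonneg (σ : ℝ) : 0 ≤ realLambda σ := by
  have := norm_completedRiemannZeta₀_le (σ : ℂ)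
  rw [ofReal_re] at this
  exact (norm_nonneg _).trans this

/-- With s = 1/2 + √w, |Λ₀(s)| ≤ Λ₀(0) + Λ₀(2n) for an integer n close to √|w|, and Λ₀(2n) = O(n^n)
because ζ(2n) is bounded and Γ(n) = (n-1)!. -/
theorem exists_norm_xiSq_le : ∃ A : ℝ, ∀ w, ‖xiSq w‖ ≤
    Real.exp (A + (√‖w‖ + 5) * Real.log (√‖w‖ + 3)) := by
  set Z := ∑' k : ℕ, 1 / (k : ℝ) ^ 2
  have hZ : 0 ≤ Z := tsum_nonneg fun _ => by positivity
  set B := realLambda 0 + (Z + 1) with hB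
  have hB0 : 0 ≤ B := by have := realLambda_nonneg 0; positivity
  refine ⟨Real.log (B + 1), fun w => ?_⟩
  set t := w ^ (1 / 2 : ℂ) with ht
  have htn : ‖t‖ = √‖w‖ := by
    rw [eq_comm, Real.sqrt_eq_iff_eq_sq (norm_nonneg _) (norm_nonneg _), ← norm_pow, ht,
      cpow_half_sq]
  set r := √‖w‖
  have hr : 0 ≤ r := Real.sqrt_nonneg _
  -- The principal root lies in the closed right half plane, so 0 is a lower endpoint for Re s.
  have htre : 0 ≤ t.re := by
    by_cases hw : w = 0
    · simp [ht, hw]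
    · rw [ht, cpow_def_of_ne_zero hw, exp_re]
      refine mul_nonneg (Real.exp_pos _).le (Real.cos_nonneg_of_mem_Icc ?_)
      have h1 : (log w * (1 / 2)).im = w.arg / 2 := by
        rw [show (1 / 2 : ℂ) = ((1 / 2 : ℝ) : ℂ) by push_cast; rfl, im_mul_ofReal, log_im]
        ring
      rw [h1]
      constructor <;> linarith [neg_pi_lt_arg w, arg_le_pi w]
  set s : ℂ := 1 / 2 + t with hs
  -- This gives r + 1 ≤ n ≤ r + 2, so that Re s ≤ r + 1/2 ≤ 2n.
  set n := ⌈r⌉₊ + 1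
  have hn : 1 ≤ n := by omega
  have hnr : (n : ℝ) ≤ r + 2 := by
    have := Nat.ceil_lt_add_one hr
    simp only [n]
    push_cast
    linarith
  have hrn : r + 1 ≤ n := by
    have := Nat.le_ceil r
    simp only [n]
    push_cast
    linarith
  have hsre : s.re = 1 / 2 + t.re := by simp [hs]
  have htr : t.re ≤ r := htn ▸ re_le_norm t
  have hs1 : ‖s‖ ≤ r + 3 := by
    refine (norm_add_le _ _).trans ?_
    rw [htn]
    norm_num
    linarith
  have hs2 : ‖s - 1‖ ≤ r + 3 := by
    rw [show s - 1 = -(1 / 2) + t by rw [hs]; ring]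
    refine (norm_add_le _ _).trans ?_
    rw [htn]
    norm_num
    linarith
  have hn1 : 1 ≤ (n : ℝ) ^ n := one_le_pow₀ (by exact_mod_cast hn)
  have hΛ : ‖completedRiemannZeta₀ s‖ ≤ B * (r + 3) ^ (r + 3) := by
    refine (norm_completedRiemannZeta₀_le s).trans ?_
    refine (realLambda_le_add (a := 0) (b := 2 * n) (by linarith) (by linarith)).trans ?_
    have h1 : realLambda 0 ≤ realLambda 0 * (n : ℝ) ^ n :=
      le_mul_of_one_le_right (realLambda_nonneg 0) hn1
    have h2 := realLambda_two_mul_le hn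
    have h3 : (n : ℝ) ^ n ≤ (r + 3) ^ (r + 3) := by
      rw [← Real.rpow_natCast]
      calc (n : ℝ) ^ (n : ℝ) ≤ (r + 3) ^ (n : ℝ) :=
            Real.rpow_le_rpow (by positivity) (by linarith) (by positivity)
        _ ≤ _ := Real.rpow_le_rpow_of_exponent_le (by linarith) (by linarith)
    calc _ ≤ B * (n : ℝ) ^ n := by rw [hB]; linarith
      _ ≤ _ := by gcongr
  have hq : 0 < r + 3 := by linarith
  have hfin : (r + 3) * (r + 3) * (r + 3) ^ (r + 3) = (r + 3) ^ (r + 5) := by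
    rw [show r + 5 = (r + 3) + (2 : ℕ) by push_cast; ring, Real.rpow_add_natCast hq.ne']
    ring
  have h1q : 1 ≤ (r + 3) ^ (r + 5) := Real.one_le_rpow (by linarith) (by linarith)
  calc ‖xiSq w‖ ≤ ‖s‖ * ‖s - 1‖ * ‖completedRiemannZeta₀ s‖ + 1 := by
        change ‖s * (s - 1) * completedRiemannZeta₀ s + 1‖ ≤ _
        refine (norm_add_le _ _).trans ?_
        rw [norm_mul, norm_mul, norm_one]
    _ ≤ (r + 3) * (r + 3) * (B * (r + 3) ^ (r + 3)) + 1 := by gcongr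
    _ = B * (r + 3) ^ (r + 5) + 1 := by rw [← hfin]; ring
    _ ≤ (B + 1) * (r + 3) ^ (r + 5) := by linarith
    _ = _ := by
        rw [Real.exp_add, Real.exp_log (by linarith), Real.rpow_def_of_pos hq, mul_comm (r + 5)]

theorem tendsto_xiSq_growth (A : ℝ) :
    Tendsto (fun x => (A + (√x + 5) * Real.log (√x + 3)) / x) atTop (𝓝 0) := by
  have h1 : (fun u : ℝ => u + 5) =O[atTop] fun u => u :=
    (isBigO_refl _ _).add (isLittleO_const_id_atTop 5).isBigO
  have h2 : (fun u : ℝ => u + 3) =O[atTop] fun u => u :=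
    (isBigO_refl _ _).add (isLittleO_const_id_atTop 3).isBigO
  have h3 : (fun u : ℝ => Real.log (u + 3)) =o[atTop] fun u => u :=
    (Real.isLittleO_log_id_atTop.comp_tendsto
      (tendsto_atTop_add_const_right atTop (3 : ℝ) tendsto_id)).trans_isBigO h2
  have h4 := (h1.mul_isLittleO h3).comp_tendsto Real.tendsto_sqrt_atTop
  have h5 : (fun x : ℝ => A + (√x + 5) * Real.log (√x + 3)) =o[atTop] fun x => x := by
    refine (isLittleO_const_id_atTop A).add (h4.congr' EventuallyEq.rfl ?_)
    filter_upwards [eventually_ge_atTop 0] with x hx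
    exact Real.mul_self_sqrt hx
  exact h5.tendsto_div_nhds_zero

end

/-! ### Partial fractions for entire functions of growth exp(o(|z|)). -/

section

open Complex Set Filter Topology Metric

theorem analyticOrderAt_ne_top_of_entire {f : ℂ → ℂ} (hf : Differentiable ℂ f) {a : ℂ}
    (ha : f a ≠ 0) (z : ℂ) : analyticOrderAt f z ≠ ⊤ := by
  have hA : AnalyticOnNhd ℂ f univ := hf.differentiableOn.analyticOnNhd isOpen_univ
  refine hA.analyticOrderAt_ne_top_of_isPreconnected isPreconnected_univ (mem_univ a)
    (mem_univ z) ?_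
  rw [((hA a (mem_univ a)).analyticOrderAt_eq_zero).mpr ha]
  simp

theorem finite_zeros_closedBall {f : ℂ → ℂ} (hf : Differentiable ℂ f) {a : ℂ} (ha : f a ≠ 0)
    (R : ℝ) : {w | f w = 0 ∧ ‖w‖ ≤ R}.Finite := by
  have hA : AnalyticOnNhd ℂ f univ := hf.differentiableOn.analyticOnNhd isOpen_univ
  have h := hA.preimage_zero_mem_codiscrete (x := a) ha
  obtain ⟨h1, h2⟩ := mem_codiscrete'.mp h
  have h3 : (f ⁻¹' {0}ᶜ)ᶜ = {w | f w = 0} := by ext; simp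
  have h4 : IsClosed {w | f w = 0} := by rw [← h3]; exact h1.isClosed_compl
  rw [h3] at h2
  refine (((isCompact_closedBall (0 : ℂ) R).inter_right h4).finite
    (h2.mono inter_subset_right)).subset ?_
  rintro w ⟨h5, h6⟩
  exact ⟨by simpa using h6, h5⟩

/-- An entire function is divisible by `(z - a) ^ m`, `m` the order of its zero `a`. -/
theorem exists_entire_eq_pow_mul {f : ℂ → ℂ} (hf : Differentiable ℂ f) {a : ℂ}
    (ha : analyticOrderAt f a ≠ ⊤) :
    ∃ g : ℂ → ℂ, Differentiable ℂ g ∧ g a ≠ 0 ∧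
      ∀ z, f z = (z - a) ^ analyticOrderNatAt f a * g z := by
  classical
  obtain ⟨g, hg, hga, hfg⟩ := (hf.analyticAt a).analyticOrderAt_ne_top.mp ha
  set n := analyticOrderNatAt f a
  refine ⟨fun z => if z = a then g a else f z / (z - a) ^ n, fun z => ?_, by simpa using hga,
    fun z => ?_⟩
  · by_cases hz : z = a
    · subst hz
      refine hg.differentiableAt.congr_of_eventuallyEq ?_
      filter_upwards [hfg] with y hy
      split_ifs with h
      · rw [h]
      · rw [hy, smul_eq_mul, mul_div_cancel_left₀ _ (pow_ne_zero _ (sub_ne_zero.mpr h))]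
    · have h1 : DifferentiableAt ℂ (fun z => f z / (z - a) ^ n) z :=
        (hf z).div (by fun_prop) (pow_ne_zero _ (sub_ne_zero.mpr hz))
      refine h1.congr_of_eventuallyEq ?_
      filter_upwards [isOpen_ne.mem_nhds hz] with y hy
      exact if_neg hy
  · by_cases hz : z = a
    · subst hz
      simpa using hfg.self_of_nhds
    · simp only [if_neg hz]
      rw [mul_div_cancel₀ _ (pow_ne_zero _ (sub_ne_zero.mpr hz))]

theorem exists_entire_eq_prod_mul {f : ℂ → ℂ} (hf : Differentiable ℂ f)
    (hord : ∀ z, analyticOrderAt f z ≠ ⊤) (S : Finset ℂ) :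
    ∃ h : ℂ → ℂ, Differentiable ℂ h ∧ (∀ w ∈ S, h w ≠ 0) ∧
      ∀ z, f z = (∏ w ∈ S, (z - w) ^ analyticOrderNatAt f w) * h z := by
  classical
  induction S using Finset.induction_on with
  | empty => exact ⟨f, hf, by simp, by simp⟩
  | insert a S ha ih =>
    obtain ⟨h, hh, hS, hfh⟩ := ih
    set P : ℂ → ℂ := fun z => ∏ w ∈ S, (z - w) ^ analyticOrderNatAt f w with hP
    have hPd : Differentiable ℂ P := by fun_prop
    have hPa : P a ≠ 0 := Finset.prod_ne_zero_iff.mpr fun w hw =>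
      pow_ne_zero _ (sub_ne_zero.mpr fun e => ha (e ▸ hw))
    have hord' : analyticOrderAt f a = analyticOrderAt h a := by
      have h1 : f = P * h := funext hfh
      conv_lhs => rw [h1]
      rw [analyticOrderAt_mul (hPd.analyticAt a) (hh.analyticAt a),
        ((hPd.analyticAt a).analyticOrderAt_eq_zero).mpr hPa, zero_add]
    obtain ⟨g, hg, hga, hhg⟩ := exists_entire_eq_pow_mul hh (hord' ▸ hord a)
    have hn : analyticOrderNatAt f a = analyticOrderNatAt h a := by
      rw [analyticOrderNatAt, hord', analyticOrderNatAt]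
    refine ⟨g, hg, fun w hw => ?_, fun z => ?_⟩
    · rcases Finset.mem_insert.mp hw with rfl | hw
      · exact hga
      · exact right_ne_zero_of_mul (hhg w ▸ hS w hw)
    · rw [Finset.prod_insert ha, hfh, hhg, hn]
      ring

theorem exists_log_on_ball {F : ℂ → ℂ} (hF : Differentiable ℂ F) {R : ℝ} (hR : 0 < R)
    (h0 : ∀ z ∈ ball (0 : ℂ) R, F z ≠ 0) :
    ∃ L : ℂ → ℂ, L 0 = 0 ∧ (∀ z ∈ ball (0 : ℂ) R, HasDerivAt L (logDeriv F z) z) ∧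
      ∀ z ∈ ball (0 : ℂ) R, F z = F 0 * exp (L z) := by
  have hF' : Differentiable ℂ (deriv F) := by
    simpa using (hF.contDiff (n := 2)).differentiable_deriv_two
  have h1 : DifferentiableOn ℂ (logDeriv F) (ball 0 R) := fun z hz =>
    ((hF' z).div (hF z) (h0 z hz)).differentiableWithinAt
  obtain ⟨L, hL0, hL⟩ := h1.isExactOn_ball.with_val_at 0 0
  refine ⟨L, hL0, hL, fun z hz => ?_⟩
  have h2 : ∀ y ∈ ball (0 : ℂ) R, HasDerivAt (fun y => F y * exp (-L y)) 0 y := fun y hy => by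
    refine ((hF y).hasDerivAt.mul (hL y hy).neg.cexp).congr_deriv ?_
    have h3 := h0 y hy
    rw [logDeriv_apply]
    simp only [Pi.neg_apply]
    field_simp
    ring
  have h4 := isOpen_ball.is_const_of_deriv_eq_zero (convex_ball (0 : ℂ) R).isPreconnected
    (fun y hy => (h2 y hy).differentiableAt.differentiableWithinAt) (fun y hy => (h2 y hy).deriv)
    hz (mem_ball_self hR)
  simp only [hL0, neg_zero, exp_zero, mul_one] at h4
  rw [← h4, mul_assoc, ← exp_add, neg_add_cancel, exp_zero, mul_one]

theorem logDeriv_prod_pow_mul {h : ℂ → ℂ} (hh : Differentiable ℂ h) (S : Finset ℂ) (m : ℂ → ℕ)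
    {z : ℂ} (hz : h z ≠ 0) (hS : z ∉ S) :
    logDeriv (fun z => (∏ w ∈ S, (z - w) ^ m w) * h z) z =
      (∑ w ∈ S, (m w : ℂ) / (z - w)) + logDeriv h z := by
  have hne : ∀ w ∈ S, z - w ≠ 0 := fun w hw => sub_ne_zero.mpr fun e => hS (e ▸ hw)
  rw [logDeriv_mul z (Finset.prod_ne_zero_iff.mpr fun w hw => pow_ne_zero _ (hne w hw)) hz
    (by fun_prop) (hh z), logDeriv_prod (f := fun w z => (z - w) ^ m w) (fun w hw => pow_ne_zero _ (hne w hw))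
    (fun w _ => by fun_prop)]
  congr 1
  refine Finset.sum_congr rfl fun w hw => ?_
  rw [logDeriv_fun_pow (by fun_prop), logDeriv_apply]
  simp [div_eq_mul_inv]

/-- Dividing out the zeros of modulus at most R leaves a function without zeros in the ball of
radius R. Borel–Carathéodory bounds its logarithm on radius R/2, and Cauchy's estimate bounds the
derivative of that logarithm on radius R/4. -/
theorem norm_logDeriv_sub_sum_le {f : ℂ → ℂ} (hf : Differentiable ℂ f) (h0 : f 0 ≠ 0) {R M : ℝ}
    (hR : 0 < R) (hM : ∀ z ∈ sphere (0 : ℂ) (2 * R), ‖f z‖ ≤ Real.exp M) {S : Finset ℂ}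
    (hS : ∀ w, w ∈ S ↔ f w = 0 ∧ ‖w‖ ≤ R) {z : ℂ} (hz : ‖z‖ ≤ R / 4) (hfz : f z ≠ 0) :
    ‖logDeriv f z - ∑ w ∈ S, (analyticOrderNatAt f w : ℂ) / (z - w)‖
      ≤ 8 * (M - Real.log ‖f 0‖ + 1) / R := by
  obtain ⟨h, hh, hhS, hfh⟩ :=
    exists_entire_eq_prod_mul hf (analyticOrderAt_ne_top_of_entire hf h0) S
  set m := analyticOrderNatAt f
  -- The normalisation F(0) = f(0) amounts to dividing f by ∏ (1 - z/w)^m. On |y| = 2R one has |y -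
  -- w| ≥ R ≥ |w|, so |F| ≤ |f| there, and the maximum principle carries the bound inside.
  set c : ℂ := ∏ w ∈ S, (0 - w) ^ m w
  have hc : c ≠ 0 := left_ne_zero_of_mul (hfh 0 ▸ h0)
  set F : ℂ → ℂ := fun z => c * h z with hFdef
  have hF : Differentiable ℂ F := hh.const_mul c
  have hF0 : F 0 = f 0 := (hfh 0).symm
  have hFs : ∀ y ∈ sphere (0 : ℂ) (2 * R), ‖F y‖ ≤ Real.exp M := fun y hy => by
    refine le_trans ?_ (hM y hy)
    rw [hfh y, norm_mul, norm_mul]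
    gcongr
    rw [norm_prod, norm_prod]
    refine Finset.prod_le_prod (fun _ _ => norm_nonneg _) fun w hw => ?_
    rw [norm_pow, norm_pow]
    gcongr
    have h1 := ((hS w).mp hw).2
    have h2 : ‖y‖ = 2 * R := by simpa using hy
    have h3 := norm_sub_norm_le y w
    rw [zero_sub, norm_neg]
    linarith
  have hFb : ∀ y ∈ closedBall (0 : ℂ) (2 * R), ‖F y‖ ≤ Real.exp M := fun y hy => by
    have h1 : (2 * R) ≠ 0 := by positivity
    refine norm_le_of_forall_mem_frontier_norm_le isBounded_ball hF.diffContOnCl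
      (fun y hy => hFs y ?_) (by rwa [closure_ball _ h1])
    rwa [frontier_ball _ h1] at hy
  have hhne : ∀ y ∈ ball (0 : ℂ) R, h y ≠ 0 := fun y hy e => by
    have h1 : f y = 0 := by rw [hfh, e, mul_zero]
    exact hhS y ((hS y).mpr ⟨h1, by simpa using (mem_ball.mp hy).le⟩) e
  have hFne : ∀ y ∈ ball (0 : ℂ) R, F y ≠ 0 := fun y hy => mul_ne_zero hc (hhne y hy)
  obtain ⟨L, hL0, hL, hFL⟩ := exists_log_on_ball hF hR hFne
  -- L(0) = 0 gives only M - log |f(0)| ≥ 0; the added 1 makes the Borel–Carathéodory bound strictly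
  -- positive.
  set M' := M - Real.log ‖f 0‖ + 1 with hM'
  have hre : ∀ y ∈ ball (0 : ℂ) R, (L y).re ≤ M - Real.log ‖f 0‖ := fun y hy => by
    have h1 := hFb y (closedBall_subset_closedBall (by linarith) (ball_subset_closedBall hy))
    rw [hFL y hy, norm_mul, norm_exp, hF0,
      ← Real.exp_log (norm_pos_iff.mpr h0), ← Real.exp_add, Real.exp_le_exp] at h1
    linarith
  have hM'0 : 0 < M' := by
    have := hre 0 (mem_ball_self hR)
    rw [hL0, zero_re] at this
    linarith
  have hLd : DifferentiableOn ℂ L (ball 0 R) := fun y hy =>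
    (hL y hy).differentiableAt.differentiableWithinAt
  have hLb : ∀ y ∈ closedBall (0 : ℂ) (R / 2), ‖L y‖ ≤ 2 * M' := fun y hy => by
    have h1 : ‖y‖ ≤ R / 2 := by simpa using hy
    refine (borelCaratheodory_zero hM'0 hLd (fun y hy => ?_) hR
      (mem_ball_zero_iff.mpr (by linarith)) hL0).trans ?_
    · have := hre y hy
      change (L y).re ≤ M'
      linarith
    · rw [div_le_iff₀ (by linarith)]
      gcongr
      linarith
  have hzR : z ∈ ball (0 : ℂ) R := mem_ball_zero_iff.mpr (by linarith)
  have hsub : closedBall z (R / 4) ⊆ closedBall 0 (R / 2) := fun y hy => by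
    rw [mem_closedBall, dist_eq_norm] at hy
    rw [mem_closedBall_zero_iff]
    calc ‖y‖ = ‖(y - z) + z‖ := by ring_nf
      _ ≤ ‖y - z‖ + ‖z‖ := norm_add_le _ _
      _ ≤ R / 2 := by linarith
  have hD : ‖deriv L z‖ ≤ 2 * M' / (R / 4) := by
    refine norm_deriv_le_of_forall_mem_sphere_norm_le (by positivity) ?_
      fun y hy => hLb y (hsub (sphere_subset_closedBall hy))
    refine (hLd.mono fun y hy => ?_).diffContOnCl
    rw [closure_ball _ (by positivity)] at hy
    have := mem_closedBall_zero_iff.mp (hsub hy)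
    exact mem_ball_zero_iff.mpr (by linarith)
  have hzS : z ∉ S := fun hzS => hfz ((hS z).mp hzS).1
  have hlog : logDeriv f z - ∑ w ∈ S, (m w : ℂ) / (z - w) = deriv L z := by
    rw [(hL z hzR).deriv, hFdef, logDeriv_const_mul z c hc, funext hfh,
      logDeriv_prod_pow_mul hh S m (hhne z hzR) hzS]
    ring
  rw [hlog]
  refine hD.trans_eq ?_
  field_simp
  ring

/-- The partial sums over the zeros of an entire function of growth `exp (o(|z|))` converge to its
logarithmic derivative. -/
theorem tendsto_sum_zeros_logDeriv {f : ℂ → ℂ} (hf : Differentiable ℂ f) (h0 : f 0 ≠ 0)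
    {M : ℝ → ℝ} (hfM : ∀ z, ‖f z‖ ≤ Real.exp (M ‖z‖))
    (hM : Tendsto (fun r => M r / r) atTop (𝓝 0)) {S : ℕ → Finset ℂ}
    (hS : ∀ n w, w ∈ S n ↔ f w = 0 ∧ ‖w‖ ≤ n) {z : ℂ} (hfz : f z ≠ 0) :
    Tendsto (fun n => ∑ w ∈ S n, (analyticOrderNatAt f w : ℂ) / (z - w)) atTop
      (𝓝 (logDeriv f z)) := by
  rw [tendsto_iff_norm_sub_tendsto_zero]
  set K := 1 - Real.log ‖f 0‖
  have hlim : Tendsto (fun n : ℕ => 16 * (M (2 * (n : ℝ)) / (2 * n)) + 8 * K / n) atTop (𝓝 0) := by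
    have h1 : Tendsto (fun n : ℕ => 2 * (n : ℝ)) atTop atTop :=
      tendsto_natCast_atTop_atTop.const_mul_atTop (by norm_num)
    have h2 := ((hM.comp h1).const_mul 16).add
      (tendsto_natCast_atTop_atTop.const_div_atTop (8 * K))
    simpa using h2
  refine squeeze_zero' (Eventually.of_forall fun _ => norm_nonneg _) ?_ hlim
  filter_upwards [eventually_gt_atTop 0, eventually_ge_atTop ⌈4 * ‖z‖⌉₊] with n hn hnz
  have hn' : (0 : ℝ) < n := Nat.cast_pos.mpr hn
  have hz : ‖z‖ ≤ n / 4 := by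
    have := Nat.ceil_le.mp hnz
    linarith
  have := norm_logDeriv_sub_sum_le hf h0 hn' (M := M (2 * n)) (fun y hy => ?_) (hS n) hz hfz
  · rw [norm_sub_rev]
    refine this.trans_eq ?_
    field_simp
    ring
  · have h3 := hfM y
    rwa [mem_sphere_zero_iff_norm.mp hy] at h3

/-- The partial sums by increasing modulus converge at z = 0, so the real parts ∑ m(w) Re(-1/w) are
bounded along them. The sector condition `hsec` makes these real parts dominate 1/|w| outside a
finite set, which yields absolute convergence. Any unconditional sum must agree with the limit by
modulus. -/
theorem summable_zeros_and_logDeriv_eq {f : ℂ → ℂ} (hf : Differentiable ℂ f) (h0 : f 0 ≠ 0)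
    {M : ℝ → ℝ} (hfM : ∀ z, ‖f z‖ ≤ Real.exp (M ‖z‖))
    (hM : Tendsto (fun r => M r / r) atTop (𝓝 0)) {B K : ℝ} (hK : 0 ≤ K)
    (hsec : ∀ w, f w = 0 → B ≤ ‖w‖ → ‖w‖⁻¹ ≤ K * (-w⁻¹).re) :
    Summable (fun w : {w // f w = 0} => (analyticOrderNatAt f w : ℝ) * ‖(w : ℂ)‖⁻¹) ∧
    ∀ z, f z ≠ 0 → (Summable fun w : {w // f w = 0} =>
      (analyticOrderNatAt f w : ℂ) * (z - w)⁻¹) →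
      logDeriv f z = ∑' w : {w // f w = 0}, (analyticOrderNatAt f w : ℂ) * (z - w)⁻¹ := by
  classical
  set m := analyticOrderNatAt f
  let S : ℕ → Finset ℂ := fun n => (finite_zeros_closedBall hf h0 n).toFinset
  have hS : ∀ n w, w ∈ S n ↔ f w = 0 ∧ ‖w‖ ≤ n := fun n w => by simp [S]
  let T : ℕ → Finset {w // f w = 0} := fun n => (S n).subtype _
  have hT : ∀ n w, w ∈ T n ↔ ‖(w : ℂ)‖ ≤ n := fun n w => by simp [T, hS, w.2]
  have hTmono : Monotone T := fun a b hab w hw => by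
    rw [hT] at hw ⊢
    exact hw.trans (Nat.cast_le.mpr hab)
  have hTtop : Tendsto T atTop atTop := tendsto_atTop_finset_of_monotone hTmono fun w =>
    ⟨⌈‖(w : ℂ)‖⌉₊, (hT _ _).mpr (Nat.le_ceil _)⟩
  have hsum : ∀ (g : ℂ → ℂ) n, ∑ w ∈ S n, g w = ∑ w ∈ T n, g w := fun g n => by
    rw [Finset.sum_subtype_of_mem (s := S n) g fun w hw => ((hS n w).mp hw).1]
  have hlim : ∀ z, f z ≠ 0 → Tendsto (fun n => ∑ w ∈ T n, (m w : ℂ) * (z - (w : ℂ))⁻¹) atTop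
      (𝓝 (logDeriv f z)) := fun z hz => by
    have := tendsto_sum_zeros_logDeriv hf h0 hfM hM hS hz
    simp only [div_eq_mul_inv] at this
    exact this.congr fun n => hsum (fun w => (m w : ℂ) * (z - w)⁻¹) n
  refine ⟨?_, fun z hz hs => tendsto_nhds_unique (hlim z hz) (hs.hasSum.comp hTtop)⟩
  have hre : Tendsto (fun n => ∑ w ∈ T n, (m w : ℝ) * (-(w : ℂ)⁻¹).re) atTop
      (𝓝 (logDeriv f 0).re) := by
    refine ((continuous_re.tendsto _).comp (hlim 0 h0)).congr fun n => ?_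
    simp only [Function.comp_apply, re_sum]
    refine Finset.sum_congr rfl fun w _ => ?_
    rw [zero_sub, inv_neg, ← ofReal_natCast, re_ofReal_mul]
  obtain ⟨C, hC⟩ := hre.bddAbove_range
  let N := ⌈B⌉₊
  -- the finitely many zeros of small modulus contribute a bounded amount
  let u : {w // f w = 0} → ℝ := fun w => (m w : ℝ) * ‖(w : ℂ)‖⁻¹
  let D : ℝ := ∑ w ∈ T N, |u w - K * ((m w : ℝ) * (-(w : ℂ)⁻¹).re)|
  have hle : ∀ w, u w ≤ K * ((m w : ℝ) * (-(w : ℂ)⁻¹).re) +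
      if w ∈ T N then |u w - K * ((m w : ℝ) * (-(w : ℂ)⁻¹).re)| else 0 := fun w => by
    split_ifs with hw
    · linarith [le_abs_self (u w - K * ((m w : ℝ) * (-(w : ℂ)⁻¹).re))]
    · have h1 : B ≤ ‖(w : ℂ)‖ := (Nat.le_ceil B).trans (not_le.mp (mt (hT N w).mpr hw)).le
      have h2 := mul_le_mul_of_nonneg_left (hsec w w.2 h1) (Nat.cast_nonneg (α := ℝ) (m w))
      rw [add_zero]
      calc u w ≤ _ := h2
        _ = _ := by ring
  refine summable_of_sum_le (c := K * C + D) (fun w => by positivity) fun U => ?_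
  obtain ⟨n, hn⟩ := (hTtop.eventually (eventually_ge_atTop U)).exists
  calc ∑ w ∈ U, u w ≤ ∑ w ∈ T n, u w :=
        Finset.sum_le_sum_of_subset_of_nonneg hn fun w _ _ => by positivity
    _ ≤ ∑ w ∈ T n, (K * ((m w : ℝ) * (-(w : ℂ)⁻¹).re) +
      if w ∈ T N then |u w - K * ((m w : ℝ) * (-(w : ℂ)⁻¹).re)| else 0) :=
        Finset.sum_le_sum fun w _ => hle w
    _ ≤ K * C + D := by
        rw [Finset.sum_add_distrib, ← Finset.mul_sum]
        refine add_le_add (mul_le_mul_of_nonneg_left (hC ⟨n, rfl⟩) hK) ?_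
        rw [← Finset.sum_filter]
        refine Finset.sum_le_sum_of_subset_of_nonneg (fun w hw => ?_) fun _ _ _ => abs_nonneg _
        exact (Finset.mem_filter.mp hw).2

end

/-! ### Termwise differentiation and derivatives of g(t²). -/

section

open Set Filter Topology Metric

theorem iteratedDeriv_eqOn_of_hasDerivAt_succ {𝕜 E : Type*} [NontriviallyNormedField 𝕜]
    [NormedAddCommGroup E] [NormedSpace 𝕜 E] {F : ℕ → 𝕜 → E} {U : Set 𝕜} (hU : IsOpen U)
    (hF : ∀ k, ∀ x ∈ U, HasDerivAt (F k) (F (k + 1) x) x) (k : ℕ) :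
    EqOn (iteratedDeriv k (F 0)) (F k) U := by
  induction k with
  | zero => intro x _; simp
  | succ k ih =>
    intro x hx
    rw [iteratedDeriv_succ, (ih.eventuallyEq_of_mem (hU.mem_nhds hx)).deriv_eq, (hF k x hx).deriv]

theorem half_norm_le_norm_sub {𝕜 : Type*} [RCLike 𝕜] {z₀ z a : 𝕜} {δ : ℝ} (ha : δ ≤ ‖z₀ - a‖)
    (hz : z ∈ ball z₀ (δ / 2)) : ‖z₀ - a‖ / 2 ≤ ‖z - a‖ := by
  rw [mem_ball, dist_eq_norm, norm_sub_rev] at hz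
  have h : ‖z₀ - a‖ ≤ ‖z₀ - z‖ + ‖z - a‖ := by
    rw [← sub_add_sub_cancel z₀ z a]
    exact norm_add_le _ _
  linarith

theorem norm_mul_inv_pow_le {𝕜 : Type*} [RCLike 𝕜] {c z₀ z a : 𝕜} {δ : ℝ} (hδ : 0 < δ)
    (ha : δ ≤ ‖z₀ - a‖) (hz : z ∈ ball z₀ (δ / 2)) (p j : ℕ) :
    ‖c * ((z - a) ^ (p + j))⁻¹‖ ≤ 2 ^ (p + j) * (δ ^ j)⁻¹ * (‖c‖ * (‖z₀ - a‖ ^ p)⁻¹) := by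
  have h1 := half_norm_le_norm_sub ha hz
  have h2 : 0 < ‖z₀ - a‖ := hδ.trans_le ha
  rw [norm_mul, norm_inv, norm_pow]
  calc ‖c‖ * (‖z - a‖ ^ (p + j))⁻¹ ≤ ‖c‖ * ((‖z₀ - a‖ / 2) ^ (p + j))⁻¹ := by gcongr
    _ = 2 ^ (p + j) * (‖z₀ - a‖ ^ j)⁻¹ * (‖c‖ * (‖z₀ - a‖ ^ p)⁻¹) := by
        rw [div_pow, pow_add ‖z₀ - a‖]
        field_simp
    _ ≤ _ := by gcongr

/-- Termwise differentiation of `∑ cᵢ (z - aᵢ)⁻ⁿ`. -/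
theorem hasDerivAt_tsum_inv_pow {𝕜 ι : Type*} [RCLike 𝕜] {c a : ι → 𝕜} {z₀ : 𝕜} {δ : ℝ}
    (hδ : 0 < δ) (ha : ∀ i, δ ≤ ‖z₀ - a i‖) {p : ℕ}
    (hs : Summable fun i => ‖c i‖ * (‖z₀ - a i‖ ^ p)⁻¹) (j : ℕ) {z : 𝕜} (hz : z ∈ ball z₀ (δ / 2)) :
    HasDerivAt (fun z => ∑' i, c i * ((z - a i) ^ (p + j))⁻¹)
      (-(p + j : ℕ) * ∑' i, c i * ((z - a i) ^ (p + (j + 1)))⁻¹) z := by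
  have hδ2 : 0 < δ / 2 := by positivity
  have hne : ∀ i, ∀ y ∈ ball z₀ (δ / 2), y - a i ≠ 0 := fun i y hy => by
    have h1 := half_norm_le_norm_sub (ha i) hy
    have h2 : 0 < ‖z₀ - a i‖ := hδ.trans_le (ha i)
    exact norm_pos_iff.mp (by linarith)
  have hd : ∀ i, ∀ y ∈ ball z₀ (δ / 2), HasDerivAt (fun z => c i * ((z - a i) ^ (p + j))⁻¹)
      (-(p + j : ℕ) * (c i * ((y - a i) ^ (p + (j + 1)))⁻¹)) y := fun i y hy => by
    have h := hne i y hy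
    have h1 := ((((hasDerivAt_id y).sub_const (a i)).pow (p + j)).inv (pow_ne_zero _ h)).const_mul
      (c i)
    refine h1.congr_deriv ?_
    rcases Nat.eq_zero_or_pos (p + j) with h0 | h0
    · simp [h0]
    · obtain ⟨q, hq⟩ := Nat.exists_eq_succ_of_ne_zero h0.ne'
      rw [show p + (j + 1) = q + 2 by omega, hq]
      simp only [id, Pi.pow_apply, Nat.succ_eq_add_one, Nat.add_sub_cancel]
      field_simp
      ring
  rw [← tsum_mul_left]
  refine hasDerivAt_tsum_of_isPreconnected
    (u := fun i => (p + j : ℕ) * (2 ^ (p + (j + 1)) * (δ ^ (j + 1))⁻¹ *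
      (‖c i‖ * (‖z₀ - a i‖ ^ p)⁻¹)))
    ((hs.mul_left _).mul_left _) isOpen_ball (convex_ball z₀ (δ / 2)).isPreconnected hd
    (fun i y hy => ?_) (mem_ball_self hδ2) ?_ hz
  · rw [norm_mul, norm_neg, RCLike.norm_natCast]
    gcongr
    exact norm_mul_inv_pow_le hδ (ha i) hy p (j + 1)
  · exact Summable.of_norm_bounded (hs.mul_left (2 ^ (p + j) * (δ ^ j)⁻¹))
      fun i => norm_mul_inv_pow_le hδ (ha i) (mem_ball_self hδ2) p j

/-- Derivatives of a function whose derivative near `z₀` is `∑ cᵢ (z - aᵢ)⁻ᵖ` up to sign and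
factorials. -/
theorem iteratedDeriv_tsum_inv_pow {𝕜 ι : Type*} [RCLike 𝕜] {c a : ι → 𝕜} {z₀ : 𝕜} {δ : ℝ}
    (hδ : 0 < δ) (ha : ∀ i, δ ≤ ‖z₀ - a i‖) {p : ℕ}
    (hs : Summable fun i => ‖c i‖ * (‖z₀ - a i‖ ^ (p + 1))⁻¹) (j : ℕ) :
    iteratedDeriv j (fun z => ∑' i, c i * ((z - a i) ^ (p + 1))⁻¹) z₀ =
      (-1) ^ j * ((p + j).factorial / p.factorial) * ∑' i, c i * ((z₀ - a i) ^ (p + 1 + j))⁻¹ := by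
  have h := iteratedDeriv_eqOn_of_hasDerivAt_succ (F := fun j z =>
    (-1) ^ j * ((p + j).factorial / p.factorial) * ∑' i, c i * ((z - a i) ^ (p + 1 + j))⁻¹)
    (isOpen_ball (x := z₀) (ε := δ / 2)) (fun j z hz => by
      refine ((hasDerivAt_tsum_inv_pow hδ ha hs j hz).const_mul _).congr_deriv ?_
      rw [← add_assoc p j 1, Nat.factorial_succ]
      push_cast
      ring) j (mem_ball_self (by positivity))
  have hp : (p.factorial : 𝕜) ≠ 0 := by exact_mod_cast p.factorial_ne_zero
  simpa [hp] using h

/-- Leibniz's rule has only two terms, and the one carrying x vanishes at 0. For m = 0 the truncated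
index m - 1 is harmless because of the factor m. -/
theorem iteratedDeriv_id_mul_zero {u : ℝ → ℂ} (hu : AnalyticAt ℝ u 0) (m : ℕ) :
    iteratedDeriv m (fun x : ℝ => (x : ℂ) * u x) 0 = m * iteratedDeriv (m - 1) u 0 := by
  have hF : ∀ k : ℕ, ∀ᶠ x : ℝ in 𝓝 0, iteratedDeriv k (fun x : ℝ => (x : ℂ) * u x) x =
      x * iteratedDeriv k u x + k * iteratedDeriv (k - 1) u x := fun k => by
    induction k with
    | zero => simp
    | succ k ih =>
      filter_upwards [ih.eventually_nhds, hu.eventually_analyticAt] with x hx hux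
      rw [iteratedDeriv_succ, EventuallyEq.deriv_eq hx]
      have h1 : ∀ n, HasDerivAt (iteratedDeriv n u) (iteratedDeriv (n + 1) u x) x := fun n => by
        rw [iteratedDeriv_succ, iteratedDeriv_eq_iterate]
        exact (hux.iterated_deriv n).differentiableAt.hasDerivAt
      have h2 : HasDerivAt (fun x : ℝ => (x : ℂ)) 1 x := Complex.ofRealCLM.hasDerivAt
      refine HasDerivAt.deriv
        (((h2.mul (h1 k)).add ((h1 (k - 1)).const_mul (k : ℂ))).congr_deriv ?_)
      rcases k with _ | k
      · simp; ring
      · simp only [Nat.add_sub_cancel]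
        push_cast
        ring
  simpa using (hF m).self_of_nhds

/-- The even-order derivatives at `0` of `t ↦ g (t ^ 2)`. -/
theorem iteratedDeriv_comp_sq_zero (m : ℕ) {g : ℝ → ℂ} (hg : AnalyticAt ℝ g 0) :
    iteratedDeriv (2 * m) (fun t => g (t ^ 2)) 0 =
      (2 * m).factorial / m.factorial * iteratedDeriv m g 0 := by
  induction m generalizing g with
  | zero => simp
  | succ m ih =>
    -- The second derivative of g(t²) is h(t²), so the induction hypothesis applies to h. Its m-th
    -- derivative at 0 is (4m + 2) times that of order m + 1 of g, which is the required ratio of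
    -- factorials.
    set h : ℝ → ℂ := fun w => 2 * deriv g w + 4 * (w * deriv (deriv g) w) with hh
    have hofReal : AnalyticAt ℝ (fun x : ℝ => (x : ℂ)) 0 := Complex.ofRealCLM.analyticAt 0
    have hu : AnalyticAt ℝ (fun w : ℝ => (w : ℂ) * deriv (deriv g) w) 0 :=
      hofReal.mul hg.deriv.deriv
    have hha : AnalyticAt ℝ h 0 :=
      (analyticAt_const.mul hg.deriv).add (analyticAt_const.mul hu)
    have hsq : Tendsto (fun t : ℝ => t ^ 2) (𝓝 0) (𝓝 0) := by
      have : ContinuousAt (fun t : ℝ => t ^ 2) 0 := by fun_prop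
      simpa [ContinuousAt] using this
    have hcomp : ∀ {f : ℝ → ℂ} {t : ℝ}, DifferentiableAt ℝ f (t ^ 2) →
        HasDerivAt (fun t : ℝ => f (t ^ 2)) (2 * t * deriv f (t ^ 2)) t := fun {f t} hf => by
      have h0 : HasDerivAt (fun t : ℝ => t ^ 2) (2 * t) t := by simpa using hasDerivAt_pow 2 t
      refine (HasDerivAt.scomp (h := fun t : ℝ => t ^ 2) t hf.hasDerivAt h0).congr_deriv ?_
      simp
    have h1 : deriv (fun t => g (t ^ 2)) =ᶠ[𝓝 0] fun t => 2 * t * deriv g (t ^ 2) := by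
      filter_upwards [hsq.eventually hg.eventually_analyticAt] with t ht
      exact (hcomp ht.differentiableAt).deriv
    have h2 : deriv (deriv fun t => g (t ^ 2)) =ᶠ[𝓝 0] fun t => h (t ^ 2) := by
      filter_upwards [h1.eventually_nhds, hsq.eventually hg.deriv.eventually_analyticAt]
        with t ht1 ht2
      rw [EventuallyEq.deriv_eq ht1]
      have h3 : HasDerivAt (fun t : ℝ => 2 * (t : ℂ)) (2 * 1) t :=
        (Complex.ofRealCLM.hasDerivAt (x := t)).const_mul 2
      refine HasDerivAt.deriv ((h3.mul (hcomp ht2.differentiableAt)).congr_deriv ?_)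
      rw [hh]
      push_cast
      ring
    rw [show 2 * (m + 1) = 2 * m + 1 + 1 by ring, iteratedDeriv_succ', iteratedDeriv_succ',
      (h2.iteratedDeriv_eq (2 * m)), ih hha, hh]
    have h4 : iteratedDeriv m (fun w : ℝ => 2 * deriv g w + 4 * (w * deriv (deriv g) w)) 0 =
        2 * iteratedDeriv (m + 1) g 0 + 4 * (m * iteratedDeriv (m + 1) g 0) := by
      have h5 := iteratedDeriv_fun_add (n := m) (f := fun w : ℝ => 2 * deriv g w)
        (g := fun w : ℝ => 4 * (w * deriv (deriv g) w)) (x := 0)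
        (analyticAt_const.mul hg.deriv).contDiffAt (analyticAt_const.mul hu).contDiffAt
      rw [h5, iteratedDeriv_const_mul_field, iteratedDeriv_const_mul_field,
        iteratedDeriv_id_mul_zero hg.deriv.deriv, ← iteratedDeriv_succ']
      rcases m with _ | m
      · simp
      · rw [Nat.add_sub_cancel, ← iteratedDeriv_succ', ← iteratedDeriv_succ']
    rw [h4, Nat.factorial_succ, Nat.factorial_succ (2 * m), Nat.factorial_succ m]
    have h6 : (m.factorial : ℂ) ≠ 0 := by exact_mod_cast m.factorial_ne_zero
    have h7 : (m + 1 : ℂ) ≠ 0 := by exact_mod_cast m.succ_ne_zero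
    push_cast
    field_simp
    ring

end

/-! ### Zeros of Ξ(1/2 + √w) and its logarithmic derivative. -/

section

open Complex Set Filter Topology

theorem riemannXiEntire_eq_mul_riemannZeta {s : ℂ} (hs : 0 < s.re) (hs1 : s ≠ 1) :
    riemannXiEntire s = s * (s - 1) * Gammaℝ s * riemannZeta s := by
  have h0 : s ≠ 0 := fun h => by simp [h] at hs
  have h1 : 1 - s ≠ 0 := sub_ne_zero.mpr hs1.symm
  rw [riemannZeta_def_of_ne_zero h0, completedRiemannZeta_eq, riemannXiEntire]
  have := Gammaℝ_ne_zero_of_re_pos hs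
  field_simp
  ring

theorem riemannXiEntire_eq_zero_iff {s : ℂ} (hs : 0 < s.re) (hs1 : s ≠ 1) :
    riemannXiEntire s = 0 ↔ riemannZeta s = 0 := by
  have h0 : s ≠ 0 := fun h => by simp [h] at hs
  rw [riemannXiEntire_eq_mul_riemannZeta hs hs1]
  simp [h0, sub_ne_zero.mpr hs1, Gammaℝ_ne_zero_of_re_pos hs]

theorem re_lt_one_of_riemannXiEntire_eq_zero {s : ℂ} (h : riemannXiEntire s = 0) : s.re < 1 := by
  by_contra! hs
  have h1 : s ≠ 1 := fun h1 => by simp [h1, riemannXiEntire_one] at h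
  exact riemannZeta_ne_zero_of_one_le_re hs
    ((riemannXiEntire_eq_zero_iff (by linarith) h1).mp h)

theorem re_pos_of_riemannXiEntire_eq_zero {s : ℂ} (h : riemannXiEntire s = 0) : 0 < s.re := by
  rw [← riemannXiEntire_one_sub] at h
  have := re_lt_one_of_riemannXiEntire_eq_zero h
  rw [sub_re, one_re] at this
  linarith

theorem im_ne_zero_of_riemannXiEntire_eq_zero {s : ℂ} (h : riemannXiEntire s = 0) : s.im ≠ 0 := by
  intro hi
  refine riemannXiEntire_ne_zero_of_mem_Icc (σ := s.re)
    ⟨(re_pos_of_riemannXiEntire_eq_zero h).le, (re_lt_one_of_riemannXiEntire_eq_zero h).le⟩ ?_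
  rwa [show (s.re : ℂ) = s from Complex.ext rfl (by simp [hi])]

theorem mem_upperNontrivialZeros_iff {s : ℂ} :
    s ∈ upperNontrivialZeros ↔ riemannXiEntire s = 0 ∧ 0 < s.im := by
  constructor
  · rintro ⟨h1, h2, h3, h4⟩
    exact ⟨(riemannXiEntire_eq_zero_iff h2 (fun h => by simp [h] at h3)).mpr h1, h4⟩
  · rintro ⟨h1, h2⟩
    have h3 := re_pos_of_riemannXiEntire_eq_zero h1
    have h4 := re_lt_one_of_riemannXiEntire_eq_zero h1
    exact ⟨(riemannXiEntire_eq_zero_iff h3 (fun h => by simp [h] at h4)).mp h1, h3, h4, h2⟩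

theorem analyticOrderAt_riemannXiEntire {s : ℂ} (hs : 0 < s.re) (hs1 : s ≠ 1) :
    analyticOrderAt riemannXiEntire s = analyticOrderAt riemannZeta s := by
  have h0 : s ≠ 0 := fun h => by simp [h] at hs
  have hG : AnalyticAt ℂ Gammaℝ s := by
    have h1 := (differentiable_Gammaℝ_inv.analyticAt s).inv
      (inv_ne_zero (Gammaℝ_ne_zero_of_re_pos hs))
    simpa [Pi.inv_def] using h1
  set k : ℂ → ℂ := fun s => s * (s - 1) * Gammaℝ s
  have hk : AnalyticAt ℂ k s := (analyticAt_id.mul (analyticAt_id.sub analyticAt_const)).mul hG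
  have hk0 : k s ≠ 0 := mul_ne_zero (mul_ne_zero h0 (sub_ne_zero.mpr hs1))
    (Gammaℝ_ne_zero_of_re_pos hs)
  have hζ : AnalyticAt ℂ riemannZeta s := by
    have h1 : DifferentiableOn ℂ riemannZeta {1}ᶜ := fun z hz =>
      (differentiableAt_riemannZeta hz).differentiableWithinAt
    exact h1.analyticAt (isOpen_compl_singleton.mem_nhds hs1)
  have h2 : riemannXiEntire =ᶠ[𝓝 s] k * riemannZeta := by
    filter_upwards [(isOpen_lt continuous_const continuous_re).mem_nhds hs,
      isOpen_compl_singleton.mem_nhds hs1] with z hz hz1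
    exact riemannXiEntire_eq_mul_riemannZeta hz hz1
  rw [analyticOrderAt_congr h2, analyticOrderAt_mul hk hζ, hk.analyticOrderAt_eq_zero.mpr hk0,
    zero_add]

/-- The map s ↦ (s - 1/2)² is locally biholomorphic at ρ ≠ 1/2, and near ρ the quotient Ξ/ζ is
analytic and nonzero. -/
theorem analyticOrderNatAt_xiSq {ρ : ℂ} (hρ : ρ ∈ upperNontrivialZeros) :
    analyticOrderNatAt xiSq ((ρ - 1 / 2) ^ 2) = analyticOrderNatAt riemannZeta ρ := by
  obtain ⟨_, h1, h2, h3⟩ := hρ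
  have hne : ρ ≠ 1 := fun h => by simp [h] at h2
  have hd : HasDerivAt (fun s : ℂ => (s - 1 / 2) ^ 2) (2 * (ρ - 1 / 2)) ρ := by
    refine (((hasDerivAt_id' ρ).sub_const (1 / 2)).fun_pow 2).congr_deriv ?_
    norm_num
  have h4 : xiSq ∘ (fun s : ℂ => (s - 1 / 2) ^ 2) = riemannXiEntire := by
    ext s
    rw [Function.comp_apply, xiSq_sq]
    congr 1
    ring
  have h5 := analyticOrderAt_comp_of_deriv_ne_zero (f := xiSq)
    (g := fun s : ℂ => (s - 1 / 2) ^ 2) (z₀ := ρ) (by fun_prop) (by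
      rw [hd.deriv]
      refine mul_ne_zero two_ne_zero fun h => ?_
      have := congrArg im h
      simp at this
      exact h3.ne' this)
  rw [h4, analyticOrderAt_riemannXiEntire h1 hne] at h5
  rw [analyticOrderNatAt, analyticOrderNatAt, h5]

/-- The zeros of `Ξ(1/2 + √w)` are the `(ρ - 1/2)²`, `ρ` a nontrivial zero in the upper half
plane. -/
theorem exists_equiv_zeros_xiSq : ∃ e : upperNontrivialZeros ≃ {w // xiSq w = 0},
    ∀ ρ, (e ρ : ℂ) = ((ρ : ℂ) - 1 / 2) ^ 2 := by
  have hz : ∀ ρ : upperNontrivialZeros, xiSq (((ρ : ℂ) - 1 / 2) ^ 2) = 0 := fun ρ => by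
    rw [xiSq_sq, add_sub_cancel]
    exact (mem_upperNontrivialZeros_iff.mp ρ.2).1
  refine ⟨Equiv.ofBijective (fun ρ => ⟨((ρ : ℂ) - 1 / 2) ^ 2, hz ρ⟩) ⟨fun ρ ρ' h => ?_, ?_⟩,
    fun ρ => rfl⟩
  · have h1 := congrArg Subtype.val h
    rcases sq_eq_sq_iff_eq_or_eq_neg.mp h1 with h2 | h2
    · exact Subtype.ext (sub_left_injective h2)
    · have h3 := congrArg im h2
      have h4 := (mem_upperNontrivialZeros_iff.mp ρ.2).2
      have h5 := (mem_upperNontrivialZeros_iff.mp ρ'.2).2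
      simp at h3
      linarith
  · rintro ⟨w, hw⟩
    set s : ℂ := 1 / 2 + w ^ (1 / 2 : ℂ) with hs
    have hs0 : riemannXiEntire s = 0 := hw
    have hsw : (s - 1 / 2) ^ 2 = w := by rw [hs, add_sub_cancel_left, cpow_half_sq]
    rcases (im_ne_zero_of_riemannXiEntire_eq_zero hs0).lt_or_gt with hi | hi
    · refine ⟨⟨1 - s, mem_upperNontrivialZeros_iff.mpr ⟨?_, by simpa using hi⟩⟩, Subtype.ext ?_⟩
      · rwa [riemannXiEntire_one_sub]
      · change (1 - s - 1 / 2) ^ 2 = w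
        rw [← hsw]
        ring
    · exact ⟨⟨s, mem_upperNontrivialZeros_iff.mpr ⟨hs0, hi⟩⟩, Subtype.ext hsw⟩

theorem zeroTau_sq (ρ : ℂ) : zeroTau ρ ^ 2 = -(ρ - 1 / 2) ^ 2 := by
  rw [zeroTau, div_pow, I_sq]
  ring

theorem zeroTau_re (ρ : ℂ) : (zeroTau ρ).re = ρ.im := by
  simp [zeroTau, div_I]

theorem xiSq_zero_ne_zero : xiSq 0 ≠ 0 := by
  have := riemannXiEntire_ne_zero_of_mem_Icc (σ := 1 / 2) ⟨by norm_num, by norm_num⟩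
  push_cast at this
  simpa [xiSq] using this

/-- Write w = (a + ib)². The critical strip gives a² < 1/4, and |w| = a² + b² ≥ 2 then forces b² ≥
3a², that is |w| ≤ -2 Re w. -/
theorem inv_norm_le_of_xiSq_eq_zero {w : ℂ} (hw : xiSq w = 0) (hB : 2 ≤ ‖w‖) :
    ‖w‖⁻¹ ≤ 2 * (-w⁻¹).re := by
  set t := w ^ (1 / 2 : ℂ) with ht
  have htw : t ^ 2 = w := cpow_half_sq w
  have h0 : riemannXiEntire (1 / 2 + t) = 0 := hw
  have h1 := re_pos_of_riemannXiEntire_eq_zero h0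
  have h2 := re_lt_one_of_riemannXiEntire_eq_zero h0
  have h3 : |t.re| < 1 / 2 := by
    rw [add_re] at h1 h2
    norm_num at h1 h2
    rw [abs_lt]
    constructor <;> linarith
  have h4 : t.re ^ 2 < 1 / 4 := by
    have := sq_lt_sq' (by linarith [(abs_lt.mp h3).1]) (abs_lt.mp h3).2
    linarith
  have hn : ‖w‖ = t.re ^ 2 + t.im ^ 2 := by
    rw [← htw, norm_pow, Complex.sq_norm, normSq_apply]
    ring
  have hre : w.re = t.re ^ 2 - t.im ^ 2 := by
    rw [← htw, sq, mul_re]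
    ring
  have hpos : 0 < ‖w‖ := by linarith
  rw [neg_re, inv_re, normSq_eq_norm_sq, ← neg_div, inv_eq_one_div, ← mul_div_assoc,
    div_le_div_iff₀ hpos (by positivity), sq, one_mul]
  have h5 : ‖w‖ ≤ 2 * -w.re := by rw [hn] at hB ⊢; rw [hre]; linarith
  have := mul_le_mul_of_nonneg_right h5 hpos.le
  linarith

/-- Partial fractions of the logarithmic derivative of `Ξ(1/2 + √w)`. -/
theorem summable_and_logDeriv_xiSq :
    Summable (fun w : {w // xiSq w = 0} => (analyticOrderNatAt xiSq w : ℝ) * ‖(w : ℂ)‖⁻¹) ∧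
    ∀ z, xiSq z ≠ 0 → (Summable fun w : {w // xiSq w = 0} =>
      (analyticOrderNatAt xiSq w : ℂ) * (z - w)⁻¹) →
      logDeriv xiSq z =
        ∑' w : {w // xiSq w = 0}, (analyticOrderNatAt xiSq w : ℂ) * (z - w)⁻¹ := by
  obtain ⟨A, hA⟩ := exists_norm_xiSq_le
  exact summable_zeros_and_logDeriv_eq differentiable_xiSq xiSq_zero_ne_zero
    (M := fun x => A + (√x + 5) * Real.log (√x + 3)) hA (tendsto_xiSq_growth A) zero_le_two
    fun w hw hB => inv_norm_le_of_xiSq_eq_zero hw hB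

theorem exists_dist_zeros {z : ℂ} (hz : xiSq z ≠ 0) :
    ∃ δ > 0, ∀ w : {w // xiSq w = 0}, δ ≤ ‖z - w‖ := by
  obtain ⟨δ, hδ, h⟩ := Metric.mem_nhds_iff.mp
    ((isOpen_ne_fun differentiable_xiSq.continuous continuous_const).mem_nhds hz)
  refine ⟨δ, hδ, fun w => ?_⟩
  by_contra! hlt
  exact h (by rwa [Metric.mem_ball, dist_comm, dist_eq_norm]) w.2

theorem summable_zeros_inv_norm_sub {z : ℂ} (hz : xiSq z ≠ 0) :
    Summable fun w : {w // xiSq w = 0} =>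
      ‖(analyticOrderNatAt xiSq w : ℂ)‖ * (‖z - w‖ ^ (0 + 1))⁻¹ := by
  obtain ⟨δ, hδ, h⟩ := exists_dist_zeros hz
  refine Summable.of_nonneg_of_le (fun _ => by positivity) (fun w => ?_)
    (summable_and_logDeriv_xiSq.1.mul_left (1 + ‖z‖ / δ))
  have hw : 0 < ‖(w : ℂ)‖ := norm_pos_iff.mpr fun e => xiSq_zero_ne_zero
    (by have h0 := w.2; rwa [e] at h0)
  have h1 : 0 < ‖z - w‖ := hδ.trans_le (h w)
  have h2 : ‖(w : ℂ)‖ ≤ (1 + ‖z‖ / δ) * ‖z - w‖ := by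
    have h3 := norm_sub_norm_le (w : ℂ) z
    rw [norm_sub_rev] at h3
    have h4 : ‖z‖ ≤ ‖z‖ / δ * ‖z - w‖ := by
      rw [div_mul_eq_mul_div, le_div_iff₀ hδ]
      exact mul_le_mul_of_nonneg_left (h w) (norm_nonneg _)
    linarith
  rw [Complex.norm_natCast, zero_add, pow_one, mul_left_comm]
  refine mul_le_mul_of_nonneg_left ?_ (Nat.cast_nonneg _)
  rw [inv_le_iff_one_le_mul₀ h1, mul_right_comm, ← div_eq_mul_inv, one_le_div hw]
  exact h2

theorem summable_zeros_inv_pow {z : ℂ} (hz : xiSq z ≠ 0) (j : ℕ) :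
    Summable fun w : {w // xiSq w = 0} =>
      (analyticOrderNatAt xiSq w : ℂ) * ((z - w) ^ (1 + j))⁻¹ := by
  obtain ⟨δ, hδ, h⟩ := exists_dist_zeros hz
  refine Summable.of_norm_bounded
    ((summable_zeros_inv_norm_sub hz).mul_left (2 ^ (1 + j) * (δ ^ j)⁻¹)) fun w => ?_
  simpa using norm_mul_inv_pow_le (c := (analyticOrderNatAt xiSq w : ℂ)) hδ (h w)
    (Metric.mem_ball_self (by positivity)) 1 j

theorem logDeriv_xiSq {z : ℂ} (hz : xiSq z ≠ 0) : logDeriv xiSq z =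
    ∑' w : {w // xiSq w = 0}, (analyticOrderNatAt xiSq w : ℂ) * (z - w)⁻¹ :=
  summable_and_logDeriv_xiSq.2 z hz (by simpa using summable_zeros_inv_pow hz 0)

theorem xiSq_ofReal_im (v : ℝ) : (xiSq v).im = 0 := by
  rw [← conj_eq_iff_im, xiSq, ← riemannXiEntire_conj]
  set t := (v : ℂ) ^ (1 / 2 : ℂ)
  have h : (starRingEnd ℂ t) ^ 2 = t ^ 2 := by
    rw [← map_pow, cpow_half_sq, conj_ofReal]
  rcases sq_eq_sq_iff_eq_or_eq_neg.mp h with h | h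
  · rw [map_add, h, map_div₀, map_one, map_ofNat]
  · rw [← riemannXiEntire_one_sub, map_add, h, map_div₀, map_one, map_ofNat]
    congr 1
    ring

/-- The range of `v` in which `Ξ(1/2 + √v)` has no zero to the right of `v`. -/
theorem xiSq_ofReal_ne_zero {v : ℝ}
    (hv : ∀ ρ ∈ upperNontrivialZeros, -(zeroTau ρ).re ^ 2 < v) : xiSq v ≠ 0 := by
  intro h0
  obtain ⟨e, he⟩ := exists_equiv_zeros_xiSq
  set ρ := e.symm ⟨v, h0⟩ with hρ
  have h1 : ((ρ : ℂ) - 1 / 2) ^ 2 = v := by rw [← he, hρ, e.apply_symm_apply]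
  have h2 := hv ρ ρ.2
  have h3 := (mem_upperNontrivialZeros_iff.mp ρ.2).2
  rw [zeroTau_re] at h2
  have h4 := congrArg im h1
  have h5 := congrArg re h1
  rw [sq, mul_im, ofReal_im] at h4
  rw [sq, mul_re, ofReal_re] at h5
  have h6 : ((ρ : ℂ) - 1 / 2).im = (ρ : ℂ).im := by simp
  rw [h6] at h4 h5
  have h7 : ((ρ : ℂ) - 1 / 2).re = 0 := by
    have : ((ρ : ℂ) - 1 / 2).re * (ρ : ℂ).im = 0 := by linarith
    exact (mul_eq_zero.mp this).resolve_right h3.ne'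
  rw [h7] at h5
  linarith

/-- On the real line the function is real and takes the value Ξ(1) = 1 at w = 1/4. A nonpositive
value at v would give a zero between v and 1/4 by the intermediate value theorem. -/
theorem xiSq_ofReal_mem_slitPlane {v : ℝ}
    (hv : ∀ ρ ∈ upperNontrivialZeros, -(zeroTau ρ).re ^ 2 < v) : xiSq v ∈ slitPlane := by
  left
  by_contra! hle
  have hcont : Continuous fun x : ℝ => (xiSq x).re :=
    continuous_re.comp (differentiable_xiSq.continuous.comp continuous_ofReal)
  have hq : (xiSq ((1 / 4 : ℝ) : ℂ)).re = 1 := by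
    rw [show ((1 / 4 : ℝ) : ℂ) = (1 / 2 : ℂ) ^ 2 by push_cast; norm_num, xiSq_sq]
    norm_num [riemannXiEntire_one]
  have hne : ∀ x : ℝ, v ≤ x → (xiSq x).re ≠ 0 := fun x hx h =>
    xiSq_ofReal_ne_zero (fun ρ hρ => (hv ρ hρ).trans_le hx)
      (Complex.ext h (xiSq_ofReal_im x))
  rcases le_total v (1 / 4) with h | h
  · obtain ⟨x, hx, hx0⟩ := intermediate_value_Icc h hcont.continuousOn
      (show (0 : ℝ) ∈ Icc _ _ from ⟨hle, by rw [hq]; exact zero_le_one⟩)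
    exact hne x hx.1 hx0
  · obtain ⟨x, hx, hx0⟩ := intermediate_value_Icc' h hcont.continuousOn
      (show (0 : ℝ) ∈ Icc _ _ from ⟨hle, by rw [hq]; exact zero_le_one⟩)
    -- Here x may lie to the left of v, so the hypothesis on v says nothing about it; but x ≥ 1/4,
    -- and every -(Re τ)² is negative.
    have h1 : xiSq x ≠ 0 := by
      have hx4 : 0 ≤ x := by linarith [hx.1]
      refine xiSq_ofReal_ne_zero fun ρ hρ => ?_
      have := (mem_upperNontrivialZeros_iff.mp hρ).2
      rw [zeroTau_re]
      have : 0 < ρ.im ^ 2 := by positivity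
      linarith
    exact h1 (Complex.ext hx0 (xiSq_ofReal_im x))

end

/-! ### Polygamma series and the zeta function of the trivial zeros. -/

section

open Set Filter Topology Metric

/-- The partial sums telescope to Euler's limit for log Γ(x), with x log(N + 1) in place of x log N;
the difference tends to 0. -/
theorem hasSum_log_Gamma_add_log {x : ℝ} (hx : 0 < x)
    (hs : Summable fun k : ℕ => x * (Real.log (k + 2) - Real.log (k + 1)) -
      (Real.log (x + (k + 1)) - Real.log (k + 1))) :
    ∑' k : ℕ, (x * (Real.log (k + 2) - Real.log (k + 1)) -
      (Real.log (x + (k + 1)) - Real.log (k + 1))) = Real.log (Real.Gamma x) + Real.log x := by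
  refine tendsto_nhds_unique hs.hasSum.tendsto_sum_nat ?_
  have h1 := ((Real.BohrMollerup.tendsto_log_gamma hx).add_const (Real.log x)).add
    (Real.tendsto_log_nat_add_one_sub_log.const_mul x)
  rw [mul_zero, add_zero] at h1
  refine h1.congr fun N => ?_
  have h2 : ∀ N : ℕ, ∑ k ∈ Finset.range N, (x * (Real.log (k + 2) - Real.log (k + 1)) -
      (Real.log (x + (k + 1)) - Real.log (k + 1))) = x * Real.log (N + 1) +
      Real.log N.factorial - ∑ m ∈ Finset.range (N + 1), Real.log (x + m) + Real.log x :=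
      fun N => by
    induction N with
    | zero => simp
    | succ N ih =>
      have h3 : (N.factorial : ℝ) ≠ 0 := by exact_mod_cast N.factorial_ne_zero
      have h4 : (N : ℝ) + 1 ≠ 0 := by positivity
      rw [Finset.sum_range_succ, ih, Finset.sum_range_succ _ (N + 1), Nat.factorial_succ]
      push_cast
      rw [Real.log_mul h4 h3, show (N : ℝ) + 1 + 1 = N + 2 by ring]
      ring
  rw [h2, Real.BohrMollerup.logGammaSeq]
  ring

/-- With j = k + 1, both log((j + 1)/j) and 1/(x + j) are at most 1/j and fall short of it by
O(1/j²), uniformly in x < B. This majorant justifies termwise differentiation. -/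
theorem abs_log_succ_sub_inv_le {B x : ℝ} (hx : x ∈ Ioo 0 B) (k : ℕ) :
    ‖(Real.log (k + 2) - Real.log (k + 1)) - (x + (k + 1))⁻¹‖ ≤
      (B + 1) * (1 / ((k : ℝ) + 1) ^ 2) := by
  set j : ℝ := k + 1 with hj
  have hj1 : 1 ≤ j := by rw [hj]; linarith [Nat.cast_nonneg (α := ℝ) k]
  have hj0 : 0 < j := by linarith
  have hB : 0 < B := hx.1.trans hx.2
  rw [show (k : ℝ) + 2 = j + 1 by rw [hj]; ring, ← Real.log_div (by positivity) hj0.ne']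
  have h1 : Real.log ((j + 1) / j) ≤ 1 / j := by
    have := Real.log_le_sub_one_of_pos (show 0 < (j + 1) / j by positivity)
    rwa [show (j + 1) / j - 1 = 1 / j by field_simp; ring] at this
  have h2 : 1 / (j + 1) ≤ Real.log ((j + 1) / j) := by
    have := Real.log_le_sub_one_of_pos (show 0 < j / (j + 1) by positivity)
    rw [← inv_div, Real.log_inv,
      show ((j + 1) / j)⁻¹ = 1 - 1 / (j + 1) by field_simp; ring] at this
    linarith
  have h3 : (x + j)⁻¹ ≤ 1 / j := by
    rw [← one_div]
    exact one_div_le_one_div_of_le hj0 (by linarith [hx.1])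
  have h4 : 1 / (j + B) ≤ (x + j)⁻¹ := by
    rw [← one_div]
    exact one_div_le_one_div_of_le (by linarith [hx.1]) (by linarith [hx.2])
  have h5 : 1 / j - 1 / (j + B) ≤ (B + 1) * (1 / j ^ 2) := by
    rw [div_sub_div _ _ hj0.ne' (by positivity), mul_one_div, div_le_div_iff₀ (by positivity)
      (by positivity)]
    nlinarith [mul_pos hB hj0, mul_pos (mul_pos hB hj0) hB, mul_pos hj0 hj0]
  have h6 : 1 / j - 1 / (j + 1) ≤ (B + 1) * (1 / j ^ 2) := by
    rw [div_sub_div _ _ hj0.ne' (by positivity), mul_one_div, div_le_div_iff₀ (by positivity)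
      (by positivity)]
    nlinarith [mul_pos hB hj0, mul_pos (mul_pos hB hj0) hj0, mul_pos hj0 hj0]
  rw [Real.norm_eq_abs, abs_le]
  constructor <;> linarith

theorem summable_one_div_succ_sq : Summable fun k : ℕ => 1 / ((k : ℝ) + 1) ^ 2 := by
  simpa using (summable_nat_add_iff 1).mpr (Real.summable_one_div_nat_pow.mpr one_lt_two)

theorem hasDerivAt_log_Gamma {x : ℝ} (hx : 0 < x) :
    HasDerivAt (fun x => Real.log (Real.Gamma x))
      (∑' k : ℕ, ((Real.log (k + 2) - Real.log (k + 1)) - (x + (k + 1))⁻¹) - x⁻¹) x := by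
  set B := x + 2
  set u : ℕ → ℝ → ℝ := fun k x => x * (Real.log (k + 2) - Real.log (k + 1)) -
      (Real.log (x + (k + 1)) - Real.log (k + 1)) with hu
  have hd : ∀ (k : ℕ), ∀ y ∈ Ioo 0 B, HasDerivAt (u k)
      ((Real.log (k + 2) - Real.log (k + 1)) - (y + (k + 1))⁻¹) y := fun k y hy => by
    have h1 : y + ((k : ℝ) + 1) ≠ 0 := by have := hy.1; positivity
    refine (((hasDerivAt_id' y).mul_const _).sub
      ((((hasDerivAt_id' y).add_const ((k : ℝ) + 1)).log h1).sub_const _)).congr_deriv ?_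
    ring
  have hsB := summable_one_div_succ_sq.mul_left (B + 1)
  have h1 : (1 : ℝ) ∈ Ioo 0 B := ⟨one_pos, by simp only [B]; linarith⟩
  -- At x = 1 every term vanishes, which gives the one point of convergence needed.
  have h0 : Summable fun k => u k 1 := by
    refine summable_zero.congr fun k => ?_
    simp only [hu]
    rw [show (1 : ℝ) + (k + 1) = k + 2 by ring]
    ring
  have hsum : ∀ y ∈ Ioo 0 B, Summable fun k => u k y := fun y hy =>
    summable_of_summable_hasDerivAt_of_isPreconnected hsB isOpen_Ioo isPreconnected_Ioo hd
      (fun k y hy => abs_log_succ_sub_inv_le hy k) h1 h0 hy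
  have hxB : x ∈ Ioo 0 B := ⟨hx, by simp only [B]; linarith⟩
  have h2 := hasDerivAt_tsum_of_isPreconnected hsB isOpen_Ioo isPreconnected_Ioo hd
      (fun k y hy => abs_log_succ_sub_inv_le hy k) h1 h0 hxB
  refine (h2.sub (Real.hasDerivAt_log hx.ne')).congr_of_eventuallyEq ?_
  filter_upwards [isOpen_Ioo.mem_nhds hxB] with y hy
  have := hasSum_log_Gamma_add_log hy.1 (hsum y hy)
  change _ = (∑' k, u k y) - Real.log y
  rw [hu, this]
  ring

theorem summable_inv_add_nat_pow {x : ℝ} (hx : 0 < x) {n : ℕ} (hn : 2 ≤ n) :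
    Summable fun k : ℕ => ((x + k) ^ n)⁻¹ := by
  refine (summable_nat_add_iff 1).mp ?_
  refine Summable.of_nonneg_of_le (fun k => by positivity) (fun k => ?_) summable_one_div_succ_sq
  have h1 : 0 ≤ (k : ℝ) := k.cast_nonneg
  push_cast
  rw [one_div]
  have h2 : ((k : ℝ) + 1) ^ 2 ≤ (x + (k + 1)) ^ n :=
    calc ((k : ℝ) + 1) ^ 2 ≤ (k + 1) ^ n := pow_le_pow_right₀ (by linarith) hn
      _ ≤ _ := pow_le_pow_left₀ (by linarith) (by linarith) n
  gcongr

theorem hasDerivAt_deriv_log_Gamma {x : ℝ} (hx : 0 < x) :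
    HasDerivAt (deriv fun x => Real.log (Real.Gamma x)) (∑' k : ℕ, ((x + k) ^ 2)⁻¹) x := by
  have hd : ∀ (k : ℕ), ∀ y ∈ Ioo 0 (x + 1), HasDerivAt (fun y =>
      ((Real.log ((k : ℝ) + 2) - Real.log ((k : ℝ) + 1)) - (y + ((k : ℝ) + 1))⁻¹))
      (((y + ((k : ℝ) + 1)) ^ 2)⁻¹) y := fun k y hy => by
    have h1 : y + ((k : ℝ) + 1) ≠ 0 := by have := hy.1; positivity
    refine ((((hasDerivAt_id' y).add_const ((k : ℝ) + 1)).inv h1).const_sub _).congr_deriv ?_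
    rw [neg_div, neg_neg, one_div]
  have hxB : x ∈ Ioo 0 (x + 1) := ⟨hx, by linarith⟩
  have h2 := hasDerivAt_tsum_of_isPreconnected summable_one_div_succ_sq isOpen_Ioo
    isPreconnected_Ioo hd (fun k y hy => ?_) hxB
    (Summable.of_norm_bounded (summable_one_div_succ_sq.mul_left (x + 1 + 1))
      fun k => abs_log_succ_sub_inv_le hxB k) hxB
  · refine ((h2.sub (hasDerivAt_inv hx.ne')).congr_of_eventuallyEq ?_).congr_deriv ?_
    · filter_upwards [isOpen_Ioi.mem_nhds hx] with y hy
      exact (hasDerivAt_log_Gamma hy).deriv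
    -- The derivative of -1/x supplies the term k = 0.
    · rw [(summable_inv_add_nat_pow hx le_rfl).tsum_eq_zero_add]
      push_cast
      rw [add_zero]
      ring
  · have h1 := hy.1
    rw [Real.norm_eq_abs, abs_of_nonneg (by positivity), one_div]
    exact inv_anti₀ (by positivity) (pow_le_pow_left₀ (by positivity) (by linarith) 2)

/-- The polygamma functions: `(log Γ)⁽ⁿ⁾(x) = (-1)ⁿ (n-1)! ∑ (x + k)⁻ⁿ` for `n ≥ 2`. -/
theorem iteratedDeriv_log_Gamma {x : ℝ} (hx : 0 < x) (j : ℕ) :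
    iteratedDeriv (j + 2) (fun x => Real.log (Real.Gamma x)) x =
      (-1) ^ j * (j + 1).factorial * ∑' k : ℕ, ((x + k) ^ (j + 2))⁻¹ := by
  have h1 : deriv (deriv fun x => Real.log (Real.Gamma x)) =ᶠ[𝓝 x]
      fun x => ∑' k : ℕ, (1 : ℝ) * ((x - (-(k : ℝ))) ^ (1 + 1))⁻¹ := by
    filter_upwards [isOpen_Ioi.mem_nhds hx] with y hy
    rw [(hasDerivAt_deriv_log_Gamma hy).deriv]
    simp
  rw [iteratedDeriv_succ', iteratedDeriv_succ', h1.iteratedDeriv_eq,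
    iteratedDeriv_tsum_inv_pow (δ := x) hx (fun k => ?_) ?_ j]
  · simp [add_comm]
  · refine (summable_inv_add_nat_pow hx le_rfl).congr fun k => ?_
    rw [sub_neg_eq_add, Real.norm_eq_abs, Real.norm_eq_abs,
      abs_of_nonneg (show 0 ≤ x + (k : ℝ) by positivity)]
    simp
  · rw [sub_neg_eq_add, Real.norm_eq_abs, abs_of_nonneg (by positivity)]
    linarith [Nat.cast_nonneg (α := ℝ) k]

theorem summable_inv_quarter_add_pow {m : ℕ} (hm : 1 ≤ m) :
    Summable fun k : ℕ => ((1 / 4 + (k : ℂ)) ^ (2 * m))⁻¹ := by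
  have h := summable_inv_add_nat_pow (show (0 : ℝ) < 1 / 4 by norm_num) (n := 2 * m) (by omega)
  have h2 := Complex.ofRealCLM.summable h
  refine h2.congr fun k => ?_
  simp

theorem shadowZetaTerm_eq (m k : ℕ) : shadowZetaTerm (2 * m : ℂ) k =
    (2 ^ (2 * m))⁻¹ * ((1 / 4 + ((k + 1 : ℕ) : ℂ)) ^ (2 * m))⁻¹ := by
  rw [shadowZetaTerm, Complex.cpow_neg, show (2 * m : ℂ) = ((2 * m : ℕ) : ℂ) by push_cast; rfl,
    Complex.cpow_natCast, ← mul_inv, ← mul_pow]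
  push_cast
  congr 2
  ring

theorem summable_shadowZetaTerm {m : ℕ} (hm : 1 ≤ m) : Summable (shadowZetaTerm (2 * m : ℂ)) := by
  have h := ((summable_nat_add_iff 1).mpr (summable_inv_quarter_add_pow hm)).mul_left
    ((2 : ℂ) ^ (2 * m))⁻¹
  exact h.congr fun k => (shadowZetaTerm_eq m k).symm

/-- As 1/2 + 2k = 2 (1/4 + k), the polygamma series at 1/4 differs from 𝐙 by scaling and by the term
k = 0, equal to (1/2)^(-2m) = 2^(2m). -/
theorem shadowZeta_eq_tsum {m : ℕ} (hm : 1 ≤ m) : shadowZeta (2 * m : ℂ) =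
    (2 ^ (2 * m))⁻¹ * ∑' k : ℕ, ((1 / 4 + (k : ℂ)) ^ (2 * m))⁻¹ - 2 ^ (2 * m) := by
  rw [shadowZeta, (summable_inv_quarter_add_pow hm).tsum_eq_zero_add, tsum_congr
    (shadowZetaTerm_eq m), tsum_mul_left, mul_add]
  have h : ((2 : ℂ) ^ (2 * m))⁻¹ * ((1 / 4 + ((0 : ℕ) : ℂ)) ^ (2 * m))⁻¹ = 2 ^ (2 * m) := by
    rw [← mul_inv, ← mul_pow, ← inv_pow]
    norm_num
  rw [h]
  ring

/-- With N = 2m, the sum over all odd n of n^(-N) is (1 - 2^(-N)) ζ(N). Adding β(N) cancels the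
class 3 mod 4 and doubles the class 1 mod 4, which is the series at 1/4 up to the factor 4^N. -/
theorem shadowZeta_eq {m : ℕ} (hm : 1 ≤ m) : shadowZeta (2 * m : ℂ) =
    1 / 2 * ((2 ^ (2 * m) - 1) * riemannZeta (2 * m : ℂ) + 2 ^ (2 * m) * betaL (2 * m : ℂ))
      - 2 ^ (2 * m) := by
  rw [shadowZeta_eq_tsum hm]
  congr 1
  set N := 2 * m with hN
  have hN2 : 1 < N := by omega
  have hcast : (2 * m : ℂ) = (N : ℂ) := by rw [hN]; push_cast; rfl
  rw [hcast]
  -- The index 0 contributes `0⁻¹ = 0`, since N > 0.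
  set a : ℕ → ℂ := fun n => ((n : ℂ) ^ N)⁻¹ with ha
  have hsa : Summable a := by
    have h := Complex.ofRealCLM.summable (Real.summable_nat_pow_inv.mpr hN2)
    exact h.congr fun k => by simp [ha]
  have hinj : ∀ p q : ℕ, 0 < p → Summable fun k => a (p * k + q) := fun p q hp =>
    hsa.comp_injective fun x y h => by
      have : p * x = p * y := by simpa using h
      exact Nat.eq_of_mul_eq_mul_left hp this
  have hζ : riemannZeta N = ∑' n, a n := by
    rw [zeta_nat_eq_tsum_of_gt_one hN2]
    simp [ha]
  have heven : ∑' k, a (2 * k) = (2 ^ N)⁻¹ * ∑' n, a n := by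
    rw [← tsum_mul_left]
    refine tsum_congr fun k => ?_
    simp only [ha]
    push_cast
    rw [mul_pow, mul_inv]
  have hsplit := tsum_even_add_odd (f := a) (hinj 2 0 two_pos) (hinj 2 1 two_pos)
  have hodd := tsum_even_add_odd (f := fun k => a (2 * k + 1))
    ((hinj 4 1 (by norm_num)).congr fun k => by ring_nf)
    ((hinj 4 3 (by norm_num)).congr fun k => by ring_nf)
  set χ := ZMod.χ₄.ringHomComp (Int.castRingHom ℂ) with hχ
  have hχv : ∀ r : ℕ, χ (r : ZMod 4) = ((ZMod.χ₄ (r : ZMod 4) : ℤ) : ℂ) := fun r => rfl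
  set b : ℕ → ℂ := fun n => χ (n : ZMod 4) * a n with hb
  have hβ : betaL N = ∑' n, b n := by
    rw [betaL, DirichletCharacter.LFunction_eq_LSeries _ (by simpa using hN2), LSeries]
    refine tsum_congr fun n => ?_
    rw [LSeries.term_def]
    split_ifs with h
    · simp [hb, ha, h, show N ≠ 0 by omega]
    · rw [Complex.cpow_natCast, div_eq_mul_inv]
  have hb0 : ∀ k, b (2 * k) = 0 := fun k => by
    have : ZMod.χ₄ ((2 * k : ℕ) : ZMod 4) = 0 := by
      rw [ZMod.χ₄_nat_eq_if_mod_four]; simp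
    simp only [hb]
    rw [hχv, this]
    simp
  have hb1 : ∀ k, b (2 * (2 * k) + 1) = a (4 * k + 1) := fun k => by
    have : ZMod.χ₄ ((4 * k + 1 : ℕ) : ZMod 4) = 1 := ZMod.χ₄_nat_one_mod_four (by omega)
    simp only [hb]
    rw [show 2 * (2 * k) + 1 = 4 * k + 1 by ring, hχv, this]
    simp
  have hb3 : ∀ k, b (2 * (2 * k + 1) + 1) = -a (4 * k + 3) := fun k => by
    have : ZMod.χ₄ ((4 * k + 3 : ℕ) : ZMod 4) = -1 := ZMod.χ₄_nat_three_mod_four (by omega)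
    simp only [hb]
    rw [show 2 * (2 * k + 1) + 1 = 4 * k + 3 by ring, hχv, this]
    simp
  have hsb1 : Summable fun k => b (2 * (2 * k) + 1) :=
    (hinj 4 1 (by norm_num)).congr fun k => (hb1 k).symm
  have hsb3 : Summable fun k => b (2 * (2 * k + 1) + 1) :=
    (hinj 4 3 (by norm_num)).neg.congr fun k => (hb3 k).symm
  have hbodd := tsum_even_add_odd (f := fun k => b (2 * k + 1)) hsb1 hsb3
  have hbsplit := tsum_even_add_odd (f := b) (summable_zero.congr fun k => (hb0 k).symm)
    (hsb1.even_add_odd hsb3)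
  rw [tsum_congr hb0, tsum_zero, zero_add, ← hbodd, tsum_congr hb1, tsum_congr hb3, tsum_neg]
    at hbsplit
  rw [heven, ← hodd, ← hζ] at hsplit
  have h41 : ∑' k, a (2 * (2 * k) + 1) = ∑' k, a (4 * k + 1) :=
    tsum_congr fun k => by ring_nf
  have h43 : ∑' k, a (2 * (2 * k + 1) + 1) = ∑' k, a (4 * k + 3) :=
    tsum_congr fun k => by ring_nf
  rw [h41, h43] at hsplit
  have hQ : ∑' k : ℕ, ((1 / 4 + (k : ℂ)) ^ N)⁻¹ = 2 ^ N * 2 ^ N * ∑' k, a (4 * k + 1) := by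
    rw [← tsum_mul_left]
    refine tsum_congr fun k => ?_
    simp only [ha]
    push_cast
    rw [← mul_pow, show (4 * k + 1 : ℂ) = 2 * 2 * (1 / 4 + k) by ring, mul_pow (2 * 2 : ℂ) (1 / 4 + k),
      mul_inv, ← mul_assoc, mul_inv_cancel₀ (pow_ne_zero _ (by norm_num)), one_mul]
  have h2 : (2 : ℂ) ^ N ≠ 0 := pow_ne_zero _ two_ne_zero
  rw [hQ, hβ, ← hbsplit]
  field_simp at hsplit ⊢
  linear_combination hsplit

end

/-! ### Derivatives of log Ξ and of log |ζ|, and the final identities. -/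

section

open Complex Set Filter Topology

theorem iteratedDeriv_comp_ofReal {f : ℂ → ℂ} {v : ℝ} (hf : AnalyticAt ℂ f v) (n : ℕ) :
    iteratedDeriv n (fun x : ℝ => f x) v = iteratedDeriv n f v := by
  have hev : ∀ᶠ x : ℝ in 𝓝 v, AnalyticAt ℂ f x :=
    continuous_ofReal.continuousAt.eventually hf.eventually_analyticAt
  have h : ∀ᶠ x : ℝ in 𝓝 v, iteratedDeriv n (fun x : ℝ => f x) x = iteratedDeriv n f x := by
    induction n with
    | zero => simp
    | succ n ih =>
      filter_upwards [ih.eventually_nhds, hev] with x hx hfx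
      rw [iteratedDeriv_succ, EventuallyEq.deriv_eq hx, iteratedDeriv_succ]
      have h1 : AnalyticAt ℂ (iteratedDeriv n f) x := by
        rw [iteratedDeriv_eq_iterate]
        exact hfx.iterated_deriv n
      exact h1.differentiableAt.hasDerivAt.comp_ofReal.deriv
  exact h.self_of_nhds

theorem iteratedDeriv_ofReal_comp {φ : ℝ → ℝ} {v : ℝ} (hφ : AnalyticAt ℝ φ v) (n : ℕ) :
    iteratedDeriv n (fun x : ℝ => (φ x : ℂ)) v = (iteratedDeriv n φ v : ℝ) := by
  have h : ∀ᶠ x : ℝ in 𝓝 v,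
      iteratedDeriv n (fun x : ℝ => (φ x : ℂ)) x = (iteratedDeriv n φ x : ℝ) := by
    induction n with
    | zero => simp
    | succ n ih =>
      filter_upwards [ih.eventually_nhds, hφ.eventually_analyticAt] with x hx hfx
      rw [iteratedDeriv_succ, EventuallyEq.deriv_eq hx, iteratedDeriv_succ]
      have h1 : AnalyticAt ℝ (iteratedDeriv n φ) x := by
        rw [iteratedDeriv_eq_iterate]
        exact hfx.iterated_deriv n
      exact h1.differentiableAt.hasDerivAt.ofReal_comp.deriv
  exact h.self_of_nhds

theorem iteratedDeriv_comp_mul_left {φ : ℝ → ℝ} {c v : ℝ} (hφ : AnalyticAt ℝ φ (c * v)) (n : ℕ) :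
    iteratedDeriv n (fun x => φ (c * x)) v = c ^ n * iteratedDeriv n φ (c * v) := by
  have hc : ContinuousAt (fun x : ℝ => c * x) v := by fun_prop
  have hev : ∀ᶠ x in 𝓝 v, AnalyticAt ℝ φ (c * x) := hc.eventually hφ.eventually_analyticAt
  have h : ∀ᶠ x in 𝓝 v,
      iteratedDeriv n (fun x => φ (c * x)) x = c ^ n * iteratedDeriv n φ (c * x) := by
    induction n with
    | zero => simp
    | succ n ih =>
      filter_upwards [ih.eventually_nhds, hev] with x hx hfx
      rw [iteratedDeriv_succ, EventuallyEq.deriv_eq hx, iteratedDeriv_succ]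
      have h1 : AnalyticAt ℝ (iteratedDeriv n φ) (c * x) := by
        rw [iteratedDeriv_eq_iterate]
        exact hfx.iterated_deriv n
      have h2 : HasDerivAt (fun x => c * x) c x := by
        simpa using (hasDerivAt_id x).const_mul c
      have h3 := (HasDerivAt.comp (h := fun x => c * x) x
        h1.differentiableAt.hasDerivAt h2).const_mul (c ^ n)
      refine HasDerivAt.deriv (h3.congr_deriv ?_)
      ring
  exact h.self_of_nhds

theorem analyticAt_comp_ofReal {f : ℂ → ℂ} {v : ℝ} (hf : AnalyticAt ℂ f v) :
    AnalyticAt ℝ (fun x : ℝ => f x) v :=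
  AnalyticAt.comp (g := f) (f := fun x : ℝ => (x : ℂ)) hf.restrictScalars
    (ofRealCLM.analyticAt v)

theorem logXiShift_eq {ε : ℂ} (hε : ε = 1 ∨ ε = -1) (v : ℝ) :
    riemannXiEntire (1 / 2 + ε * (v : ℂ) ^ (1 / 2 : ℂ)) = xiSq v := by
  rw [← xiSq_sq, mul_pow, cpow_half_sq]
  rcases hε with rfl | rfl <;> simp

theorem zerosZetaTerm_eq {e : upperNontrivialZeros ≃ {w // xiSq w = 0}}
    (he : ∀ ρ, (e ρ : ℂ) = ((ρ : ℂ) - 1 / 2) ^ 2) (n : ℕ) (v : ℝ) (ρ : upperNontrivialZeros) :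
    zerosZetaTerm (n : ℂ) v ρ =
      (analyticOrderNatAt xiSq (e ρ) : ℂ) * (((v : ℂ) - e ρ) ^ n)⁻¹ := by
  rw [zerosZetaTerm, cpow_neg, cpow_natCast, he, analyticOrderNatAt_xiSq ρ.2, zeroTau_sq,
    neg_add_eq_sub]

theorem analyticAt_log_xiSq {v : ℝ}
    (hv : ∀ ρ ∈ upperNontrivialZeros, -(zeroTau ρ).re ^ 2 < v) :
    AnalyticAt ℂ (fun z => log (xiSq z)) v :=
  (differentiable_xiSq.analyticAt _).clog (xiSq_ofReal_mem_slitPlane hv)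

theorem iteratedDeriv_log_xiSq {v : ℝ}
    (hv : ∀ ρ ∈ upperNontrivialZeros, -(zeroTau ρ).re ^ 2 < v) (j : ℕ) :
    iteratedDeriv (j + 1) (fun x : ℝ => log (xiSq x)) v = (-1) ^ j * j.factorial *
      ∑' w : {w // xiSq w = 0}, (analyticOrderNatAt xiSq w : ℂ) * (((v : ℂ) - w) ^ (j + 1))⁻¹ := by
  have hz := xiSq_ofReal_ne_zero hv
  have hs := xiSq_ofReal_mem_slitPlane hv
  obtain ⟨δ, hδ, h⟩ := exists_dist_zeros hz
  rw [iteratedDeriv_comp_ofReal (analyticAt_log_xiSq hv), iteratedDeriv_succ']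
  have h1 : deriv (fun z => log (xiSq z)) =ᶠ[𝓝 (v : ℂ)] fun z =>
      ∑' w : {w // xiSq w = 0}, (analyticOrderNatAt xiSq w : ℂ) * ((z - w) ^ (0 + 1))⁻¹ := by
    filter_upwards [differentiable_xiSq.continuous.continuousAt.eventually
      (isOpen_slitPlane.mem_nhds hs)] with z hz
    rw [((differentiable_xiSq z).hasDerivAt.clog hz).deriv, ← logDeriv_apply,
      logDeriv_xiSq (slitPlane_ne_zero hz)]
    simp
  rw [h1.iteratedDeriv_eq, iteratedDeriv_tsum_inv_pow hδ h (summable_zeros_inv_norm_sub hz)]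
  simp [add_comm]

theorem zerosZeta_eq_iteratedDeriv {v : ℝ}
    (hv : ∀ ρ ∈ upperNontrivialZeros, -(zeroTau ρ).re ^ 2 < v) {n : ℕ} (hn : 1 ≤ n) {ε : ℂ}
    (hε : ε = 1 ∨ ε = -1) :
    Summable (zerosZetaTerm (n : ℂ) v) ∧
      riemannXiEntire (1 / 2 + ε * (v : ℂ) ^ (1 / 2 : ℂ)) ≠ 0 ∧
      ContDiffAt ℝ n (logXiShift ε) v ∧
      zerosZeta (n : ℂ) v =
        (-1) ^ (n - 1) / ((n - 1).factorial : ℂ) * iteratedDeriv n (logXiShift ε) v := by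
  obtain ⟨e, he⟩ := exists_equiv_zeros_xiSq
  obtain ⟨j, rfl⟩ : ∃ j, n = j + 1 := ⟨n - 1, by omega⟩
  have hz := xiSq_ofReal_ne_zero hv
  have hlog : logXiShift ε = fun x : ℝ => log (xiSq x) := funext fun x => by
    rw [logXiShift, logXiShift_eq hε]
  have hterm : zerosZetaTerm ((j + 1 : ℕ) : ℂ) v = (fun w : {w // xiSq w = 0} =>
      (analyticOrderNatAt xiSq w : ℂ) * (((v : ℂ) - w) ^ (j + 1))⁻¹) ∘ e :=
    funext fun ρ => zerosZetaTerm_eq he (j + 1) v ρ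
  refine ⟨?_, by rwa [logXiShift_eq hε], ?_, ?_⟩
  · rw [hterm, e.summable_iff]
    simpa [add_comm] using summable_zeros_inv_pow hz j
  · rw [hlog]
    exact (analyticAt_comp_ofReal (analyticAt_log_xiSq hv)).contDiffAt
  · rw [zerosZeta, hterm, hlog, iteratedDeriv_log_xiSq hv, Nat.add_sub_cancel]
    have h1 := e.tsum_eq (fun w : {w // xiSq w = 0} =>
      (analyticOrderNatAt xiSq w : ℂ) * (((v : ℂ) - w) ^ (j + 1))⁻¹)
    have h2 : (j.factorial : ℂ) ≠ 0 := by exact_mod_cast j.factorial_ne_zero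
    have h3 : ((-1 : ℂ) ^ j) * (-1) ^ j = 1 := by rw [← mul_pow]; simp
    simp only [Function.comp_def]
    rw [h1, div_mul_eq_mul_div, eq_div_iff h2]
    linear_combination (-(j.factorial : ℂ) * ∑' w : {w // xiSq w = 0},
      (analyticOrderNatAt xiSq w : ℂ) * (((v : ℂ) - w) ^ (j + 1))⁻¹) * h3

theorem neg_zeroTau_re_sq_lt {v : ℝ} (hv : 0 ≤ v) :
    ∀ ρ ∈ upperNontrivialZeros, -(zeroTau ρ).re ^ 2 < v := fun ρ hρ => by
  have h1 := (mem_upperNontrivialZeros_iff.mp hρ).2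
  rw [zeroTau_re]
  have : 0 < ρ.im ^ 2 := by positivity
  linarith

theorem riemannZeta_one_half_ne_zero : riemannZeta (1 / 2) ≠ 0 := by
  have h := riemannXiEntire_ne_zero_of_mem_Icc (σ := 1 / 2) ⟨by norm_num, by norm_num⟩
  push_cast at h
  exact fun h0 => h ((riemannXiEntire_eq_zero_iff (by norm_num) (by norm_num)).mpr h0)

/-- Near 1/2, log |ζ| = Re log(ζ/c) + log |c| with c = ζ(1/2). Dividing by c moves the value at 1/2
to 1, away from the branch cut, whatever the sign of c. -/
theorem analyticAt_logAbsZeta : AnalyticAt ℝ logAbsZeta (1 / 2) := by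
  set c := riemannZeta (1 / 2) with hc
  have hc0 : c ≠ 0 := riemannZeta_one_half_ne_zero
  have hcast : (((1 / 2 : ℝ)) : ℂ) = 1 / 2 := by push_cast; rfl
  have h1 : DifferentiableOn ℂ riemannZeta {1}ᶜ := fun z hz =>
    (differentiableAt_riemannZeta hz).differentiableWithinAt
  have hζ : AnalyticAt ℂ riemannZeta ((1 / 2 : ℝ) : ℂ) :=
    h1.analyticAt (isOpen_compl_singleton.mem_nhds (by rw [hcast]; norm_num))
  have hL : AnalyticAt ℂ (fun z => log (riemannZeta z / c)) ((1 / 2 : ℝ) : ℂ) := by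
    refine (hζ.div analyticAt_const hc0).clog ?_
    rw [Pi.div_apply, hcast, ← hc, div_self hc0]
    exact one_mem_slitPlane
  have h2 := (reCLM.analyticAt _).comp (analyticAt_comp_ofReal hL)
  have h3 : AnalyticAt ℝ (fun x : ℝ => (log (riemannZeta x / c)).re + Real.log ‖c‖) (1 / 2) :=
    h2.add analyticAt_const
  refine h3.congr ?_
  have h4 : ∀ᶠ x : ℝ in 𝓝 (1 / 2), riemannZeta x ≠ 0 := by
    have : ContinuousAt (fun x : ℝ => riemannZeta x) (1 / 2) :=
      ContinuousAt.comp (f := fun x : ℝ => (x : ℂ)) hζ.continuousAt continuous_ofReal.continuousAt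
    exact this.eventually_ne (by rw [hcast]; exact hc0)
  filter_upwards [h4] with x hx
  rw [log_re, norm_div, Real.log_div (norm_ne_zero_iff.mpr hx) (norm_ne_zero_iff.mpr hc0),
    logAbsZeta]
  ring

theorem log_xiSq_eq_ofReal {v : ℝ} (hv : 0 ≤ v) :
    log (xiSq v) = (Real.log ‖xiSq v‖ : ℝ) := by
  have h1 := xiSq_ofReal_mem_slitPlane (neg_zeroTau_re_sq_lt hv)
  have h2 := xiSq_ofReal_im v
  have h3 : 0 < (xiSq v).re := h1.resolve_right fun h => h h2
  have h4 : xiSq v = ((xiSq v).re : ℂ) := Complex.ext rfl h2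
  rw [h4, ← ofReal_log h3.le, norm_real, Real.norm_eq_abs, abs_of_pos h3]

theorem logAbsZeta_eq {x : ℝ} (h0 : 0 < x) (h1 : x < 1) :
    (logAbsZeta x : ℂ) = log (xiSq (((x - 1 / 2) ^ 2 : ℝ) : ℂ)) -
      ((Real.log x + Real.log (1 - x) + (-(Real.log Real.pi / 2)) * x
        + Real.log (Real.Gamma (1 / 2 * x)) : ℝ) : ℂ) := by
  have hx1 : (x : ℂ) ≠ 1 := by exact_mod_cast h1.ne
  rw [log_xiSq_eq_ofReal (sq_nonneg _), ← ofReal_sub]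
  congr 1
  have hΞ : xiSq (((x - 1 / 2) ^ 2 : ℝ) : ℂ) = riemannXiEntire x := by
    push_cast
    rw [xiSq_sq]
    congr 1
    ring
  have hG : Gammaℝ (x : ℂ) = ((Real.pi ^ (-x / 2) * Real.Gamma (1 / 2 * x) : ℝ) : ℂ) := by
    rw [Gammaℝ_def, ofReal_mul, ofReal_cpow Real.pi_pos.le, ← Gamma_ofReal]
    push_cast
    congr 2
    ring
  have hΓ : 0 < Real.Gamma (1 / 2 * x) := Real.Gamma_pos_of_pos (by linarith)
  have hπ : 0 < Real.pi ^ (-x / 2) := Real.rpow_pos_of_pos Real.pi_pos _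
  have hζ : riemannZeta x ≠ 0 := by
    rw [Ne, ← riemannXiEntire_eq_zero_iff (by simpa using h0) hx1]
    exact riemannXiEntire_ne_zero_of_mem_Icc ⟨h0.le, h1.le⟩
  have hn : ‖riemannXiEntire x‖ =
      x * (1 - x) * (Real.pi ^ (-x / 2) * Real.Gamma (1 / 2 * x)) * ‖riemannZeta x‖ := by
    rw [riemannXiEntire_eq_mul_riemannZeta (by simpa using h0) hx1, hG, norm_mul, norm_mul,
      norm_mul, norm_real, norm_real, show (x : ℂ) - 1 = ((x - 1 : ℝ) : ℂ) by push_cast; rfl,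
      norm_real, Real.norm_eq_abs, Real.norm_eq_abs, Real.norm_eq_abs, abs_of_pos h0,
      abs_of_neg (sub_neg.mpr h1), abs_of_pos (mul_pos hπ hΓ), neg_sub]
  have h1x : 0 < 1 - x := by linarith
  rw [hΞ, hn, Real.log_mul (by positivity) (norm_ne_zero_iff.mpr hζ),
    Real.log_mul (by positivity) (by positivity), Real.log_mul h0.ne' h1x.ne',
    Real.log_mul hπ.ne' hΓ.ne', Real.log_rpow Real.pi_pos, logAbsZeta]
  ring

theorem analyticAt_log_Gamma {x : ℝ} (hx : 0 < x) :
    AnalyticAt ℝ (fun x => Real.log (Real.Gamma x)) x := by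
  have h1 : DifferentiableOn ℂ Gamma {z | 0 < z.re} := fun z hz => by
    refine (differentiableAt_Gamma z fun m h => ?_).differentiableWithinAt
    have : 0 < z.re := hz
    rw [h] at this
    simp at this
    linarith [Nat.cast_nonneg (α := ℝ) m]
  have h2 : AnalyticAt ℂ Gamma (x : ℂ) := h1.analyticAt
    ((isOpen_lt continuous_const continuous_re).mem_nhds (by simpa using hx))
  have h3 : AnalyticAt ℝ (fun x : ℝ => (Gamma x).re) x :=
    (reCLM.analyticAt _).comp (analyticAt_comp_ofReal h2)
  have h4 : AnalyticAt ℝ Real.Gamma x := h3.congr (Eventually.of_forall fun y => by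
    simp [Gamma_ofReal])
  exact h4.log (Real.Gamma_pos_of_pos hx)

theorem iteratedDeriv_log_one_half (j : ℕ) :
    iteratedDeriv (j + 1) Real.log (1 / 2) = (-1) ^ j * j.factorial * 2 ^ (j + 1) := by
  rw [iteratedDeriv_succ', Real.deriv_log', iteratedDeriv_eq_iterate, iter_deriv_inv,
    show (-1 - j : ℤ) = -((j + 1 : ℕ) : ℤ) by push_cast; ring, zpow_neg, zpow_natCast]
  simp

/-- At 1/2 the terms log x and log(1 - x) contribute equally because the order is even, the linear
term drops out since 2m ≥ 2, and log Γ(x/2) gives the polygamma series at 1/4 with the factor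
2^(-2m) from the chain rule. -/
theorem iteratedDeriv_zeta_correction {m : ℕ} (hm : 1 ≤ m) :
    iteratedDeriv (2 * m) (fun x : ℝ => Real.log x + Real.log (1 - x) +
        (-(Real.log Real.pi / 2)) * x + Real.log (Real.Gamma (1 / 2 * x))) (1 / 2) =
      (2 * m - 1).factorial * (-2 * 2 ^ (2 * m) +
        (2 ^ (2 * m))⁻¹ * ∑' k : ℕ, ((1 / 4 + (k : ℝ)) ^ (2 * m))⁻¹) := by
  obtain ⟨j, hj⟩ : ∃ j, 2 * m = j + 2 := ⟨2 * m - 2, by omega⟩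
  have hje : Even j := ⟨m - 1, by omega⟩
  have hlog : AnalyticAt ℝ Real.log (1 / 2) := analyticAt_log (by norm_num)
  have hlog' : AnalyticAt ℝ (fun x : ℝ => Real.log (1 - x)) (1 / 2) := by
    refine AnalyticAt.log (by fun_prop) (by norm_num)
  have hlin : AnalyticAt ℝ (fun x : ℝ => (-(Real.log Real.pi / 2)) * x) (1 / 2) := by fun_prop
  have hΓ0 : AnalyticAt ℝ (fun x => Real.log (Real.Gamma x)) (1 / 2 * (1 / 2)) :=
    analyticAt_log_Gamma (by norm_num)
  have hΓ : AnalyticAt ℝ (fun x : ℝ => Real.log (Real.Gamma (1 / 2 * x))) (1 / 2) :=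
    AnalyticAt.comp (f := fun x : ℝ => 1 / 2 * x) hΓ0 (by fun_prop)
  have h12 : AnalyticAt ℝ (fun x : ℝ => Real.log x + Real.log (1 - x)) (1 / 2) := hlog.add hlog'
  have h123 : AnalyticAt ℝ (fun x : ℝ => Real.log x + Real.log (1 - x) +
      (-(Real.log Real.pi / 2)) * x) (1 / 2) := h12.add hlin
  rw [iteratedDeriv_fun_add h123.contDiffAt hΓ.contDiffAt,
    iteratedDeriv_fun_add h12.contDiffAt hlin.contDiffAt,
    iteratedDeriv_fun_add hlog.contDiffAt hlog'.contDiffAt, iteratedDeriv_comp_mul_left hΓ0,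
    iteratedDeriv_comp_const_sub, hj, iteratedDeriv_log_Gamma (by norm_num)]
  beta_reduce
  rw [show (1 : ℝ) - 1 / 2 = 1 / 2 by norm_num, iteratedDeriv_log_one_half]
  have hlin0 : iteratedDeriv (j + 2) (fun x : ℝ => (-(Real.log Real.pi / 2)) * x) (1 / 2) = 0 := by
    rw [iteratedDeriv_succ', iteratedDeriv_succ']
    have h1 : deriv (fun x : ℝ => (-(Real.log Real.pi / 2)) * x) =
        fun _ => -(Real.log Real.pi / 2) := by
      ext x
      simp
    rw [h1, deriv_const']
    simp
  rw [hlin0, show j + 2 - 1 = j + 1 by omega, hje.neg_one_pow, pow_succ (-1 : ℝ) j,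
    pow_add (-1 : ℝ) j 2, hje.neg_one_pow,
    show (1 / 2 : ℝ) * (1 / 2) = 1 / 4 by norm_num, one_div_pow (2 : ℝ) (j + 2), one_div,
    smul_eq_mul]
  ring

theorem zerosZeta_logAbsZeta {m : ℕ} (hm : 1 ≤ m) :
    2 * (-1) ^ (m + 1) * zerosZeta (m : ℂ) 0
        - ((iteratedDeriv (2 * m) logAbsZeta (1 / 2) : ℝ) : ℂ) / ((2 * m - 1).factorial : ℂ) =
      shadowZeta (2 * m : ℂ) - 2 ^ (2 * m) := by
  have hv := neg_zeroTau_re_sq_lt (le_refl (0 : ℝ))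
  set g : ℝ → ℂ := fun v => log (xiSq v) with hg
  have hga : AnalyticAt ℝ g 0 := analyticAt_comp_ofReal (analyticAt_log_xiSq hv)
  set φ : ℝ → ℝ := fun x => Real.log x + Real.log (1 - x) +
        (-(Real.log Real.pi / 2)) * x + Real.log (Real.Gamma (1 / 2 * x)) with hφ
  have hΓ0 : AnalyticAt ℝ (fun x => Real.log (Real.Gamma x)) (1 / 2 * (1 / 2)) :=
    analyticAt_log_Gamma (by norm_num)
  have hφa : AnalyticAt ℝ φ (1 / 2) := by
    refine (((analyticAt_log (by norm_num)).add (AnalyticAt.log (by fun_prop) (by norm_num))).add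
      (by fun_prop)).add ?_
    exact AnalyticAt.comp (f := fun x : ℝ => 1 / 2 * x) hΓ0 (by fun_prop)
  have hsq : AnalyticAt ℝ (fun x : ℝ => g ((x - 1 / 2) ^ 2)) (1 / 2) := by
    refine AnalyticAt.comp (g := g) (f := fun x : ℝ => (x - 1 / 2) ^ 2) ?_ (by fun_prop)
    simpa using hga
  have hD : ((iteratedDeriv (2 * m) logAbsZeta (1 / 2) : ℝ) : ℂ) =
      (2 * m).factorial / m.factorial * iteratedDeriv m g 0 -
        (iteratedDeriv (2 * m) φ (1 / 2) : ℝ) := by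
    rw [← iteratedDeriv_ofReal_comp analyticAt_logAbsZeta]
    have h1 : (fun x : ℝ => (logAbsZeta x : ℂ)) =ᶠ[𝓝 (1 / 2)]
        fun x => g ((x - 1 / 2) ^ 2) - (φ x : ℂ) := by
      filter_upwards [Ioo_mem_nhds (show (0 : ℝ) < 1 / 2 by norm_num)
        (show (1 / 2 : ℝ) < 1 by norm_num)] with x hx
      exact logAbsZeta_eq hx.1 hx.2
    have h2 : AnalyticAt ℝ (fun x : ℝ => (φ x : ℂ)) (1 / 2) :=
      AnalyticAt.comp (f := φ) (ofRealCLM.analyticAt _) hφa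
    have h3 := iteratedDeriv_comp_sub_const (2 * m) (fun t : ℝ => g (t ^ 2)) (1 / 2)
    rw [h1.iteratedDeriv_eq, iteratedDeriv_fun_sub hsq.contDiffAt h2.contDiffAt,
      iteratedDeriv_ofReal_comp hφa, h3]
    simp only [sub_self]
    rw [iteratedDeriv_comp_sq_zero m hga]
  have hlog : logXiShift 1 = g := funext fun x => by
    rw [logXiShift, logXiShift_eq (Or.inl rfl)]
  have hZ := (zerosZeta_eq_iteratedDeriv hv hm (Or.inl rfl)).2.2.2
  rw [hlog] at hZ
  rw [hD, hZ, iteratedDeriv_zeta_correction hm, shadowZeta_eq_tsum hm]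
  obtain ⟨k, rfl⟩ : ∃ k, m = k + 1 := ⟨m - 1, by omega⟩
  have hk : ((-1 : ℂ) ^ k) * (-1) ^ k = 1 := by rw [← mul_pow]; simp
  have h1 : (k.factorial : ℂ) ≠ 0 := by exact_mod_cast k.factorial_ne_zero
  have h2 : ((2 * k + 1).factorial : ℂ) ≠ 0 := by exact_mod_cast (2 * k + 1).factorial_ne_zero
  have h3 : ((k : ℂ) + 1) ≠ 0 := by exact_mod_cast k.succ_ne_zero
  have h4 : (2 : ℂ) ^ (2 * (k + 1)) ≠ 0 := pow_ne_zero _ two_ne_zero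
  rw [show 2 * (k + 1) - 1 = 2 * k + 1 by omega, Nat.add_sub_cancel,
    show (2 * (k + 1)).factorial = (2 * k + 2) * (2 * k + 1).factorial from Nat.factorial_succ _,
    Nat.factorial_succ k]
  push_cast
  set Q := ∑' k_1 : ℕ, ((1 / 4 + (k_1 : ℂ)) ^ (2 * (k + 1)))⁻¹
  set G := iteratedDeriv (k + 1) g 0
  set T := (2 : ℂ) ^ (2 * (k + 1))
  rw [pow_succ, pow_succ]
  field_simp
  -- What remains is the cancellation of the signs (-1)^(m+1) and (-1)^(m-1); the factorials match
  -- because (2m)! (m-1)! / m! = 2 (2m-1)!.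
  linear_combination (2 * T * G) * hk

end

theorem mainTheorem6 :
    (∀ v : ℝ, (∀ ρ ∈ upperNontrivialZeros, -(zeroTau ρ).re ^ 2 < v) →
      ∀ n : ℕ, 1 ≤ n → ∀ ε : ℂ, ε = 1 ∨ ε = -1 →
        Summable (zerosZetaTerm (n : ℂ) v) ∧
        riemannXiEntire (1 / 2 + ε * (v : ℂ) ^ (1 / 2 : ℂ)) ≠ 0 ∧
        ContDiffAt ℝ n (logXiShift ε) v ∧
        zerosZeta (n : ℂ) v =
          (-1) ^ (n - 1) / ((n - 1).factorial : ℂ) * iteratedDeriv n (logXiShift ε) v) ∧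
    (∀ m : ℕ, 1 ≤ m →
      Summable (zerosZetaTerm (m : ℂ) 0) ∧
      riemannZeta (1 / 2) ≠ 0 ∧
      ContDiffAt ℝ (2 * m : ℕ) logAbsZeta (1 / 2) ∧
      Summable (shadowZetaTerm (2 * m : ℂ)) ∧
      2 * (-1) ^ (m + 1) * zerosZeta (m : ℂ) 0
          - ((iteratedDeriv (2 * m) logAbsZeta (1 / 2) : ℝ) : ℂ) / ((2 * m - 1).factorial : ℂ) =
        shadowZeta (2 * m : ℂ) - 2 ^ (2 * m) ∧
      shadowZeta (2 * m : ℂ) =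
        1 / 2 * ((2 ^ (2 * m) - 1) * riemannZeta (2 * m : ℂ) + 2 ^ (2 * m) * betaL (2 * m : ℂ))
          - 2 ^ (2 * m) ∧
      zerosZeta (m : ℂ) 0 =
        (-1) ^ m *
          (-(((iteratedDeriv (2 * m) logAbsZeta (1 / 2) : ℝ) : ℂ) / (2 * ((2 * m - 1).factorial : ℂ)))
            - 1 / 4 * ((2 ^ (2 * m) - 1) * riemannZeta (2 * m : ℂ)
                + 2 ^ (2 * m) * betaL (2 * m : ℂ))
            + 2 ^ (2 * m))) := by
  have hv := neg_zeroTau_re_sq_lt (le_refl (0 : ℝ))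
  refine ⟨fun v hv n hn ε hε => zerosZeta_eq_iteratedDeriv hv hn hε, fun m hm => ?_⟩
  have h := zerosZeta_logAbsZeta hm
  refine ⟨(zerosZeta_eq_iteratedDeriv hv hm (Or.inl rfl)).1, riemannZeta_one_half_ne_zero,
    analyticAt_logAbsZeta.contDiffAt, summable_shadowZetaTerm hm, h, shadowZeta_eq hm, ?_⟩
  rw [shadowZeta_eq hm] at h
  have h1 : ((-1 : ℂ) ^ m) * (-1) ^ m = 1 := by rw [← mul_pow]; simp
  rw [mul_comm (2 : ℂ) ((2 * m - 1).factorial : ℂ), ← div_div]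
  set D := ((iteratedDeriv (2 * m) logAbsZeta (1 / 2) : ℝ) : ℂ) / ((2 * m - 1).factorial : ℂ)
  rw [pow_succ] at h
  linear_combination (-(1 / 2) * (-1 : ℂ) ^ m) * h - zerosZeta (m : ℂ) 0 * h1
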